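/- Let $d\ge 1$, $\mathbb R^d_+=(0,\infty)^d$, and for $n\in\mathbb N_0^d$ put $|n|=n_1+\dots+n_d$ and $l_n(x)=\prod_{j=1}^d L_{n_j}(x_j)e^{-x_j/2}$, where $L_k(t)=\frac{e^t}{k!}\frac{d^k}{dt^k}(e^{-t}t^k)$. A formal Laguerre series is a formal sum $\sum_{n\in\mathbb N_0^d}a_nl_n$ with arbitrary $a_n\in\mathbb C$. Spaces. Let $\mathcal S(\mathbb R^d_+)$ be the Fréchet space of all $f\in C^\infty(\mathbb R^d_+)$ all of whose derivatives extend continuously to $[0,\infty)^d$ and for which all seminorms $\sup_{x\in\mathbb R^d_+}x^\beta|\partial^\alpha f(x)|$ ($\alpha,\beta\in\mathbb N_0^d$) are finite, and let $\mathcal S'(\mathbb R^d_+)$ be its strong dual. An element $f\in\mathcal S(\mathbb R^d_+)$ is identified with the formal series with coefficients $a_n(f)=\int_{\mathbb R^d_+}f(x)l_n(x)\,dx$, and $T\in\mathcal S'(\mathbb R^d_+)$ with the one with coefficients $a_n(T)=\langle T,l_n\rangle$. For $\alpha,h>0$ let $\mathcal G_{\alpha,h}$ and $\mathcal G'_{\alpha,h}$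 be the Banach spaces of formal Laguerre series with finite norm $\sup_n|a_n|e^{h|n|^{1/\alpha}}$, respectively $\sup_n|a_n|e^{-h|n|^{1/\alpha}}$. Put $$\mathcal G_\alpha=\bigcup_{h>0}\mathcal G_{\alpha,h},\qquad \mathcal G_{0,\alpha}=\bigcap_{h>0}\mathcal G_{\alpha,h},\qquad \mathcal G'_\alpha=\bigcap_{h>0}\mathcal G'_{\alpha,h},\qquad \mathcal G'_{0,\alpha}=\bigcup_{h>0}\mathcal G'_{\alpha,h},$$ where unions carry the locally convex inductive limit topology and intersections the projective limit topology. Operator. For $z,c\in\mathbb C$ and $r>0$ let $e^{zE^r_c}$ act on formal Laguerre series by $$e^{zE^r_c}\Big(\sum_n a_nl_n\Big)=\sum_n e^{z(|n|+c)^r}a_nl_n ,$$ with the principal branch of the power and $0^r=0$. For two of the above spaces $A,B$, the operator $e^{zE^r_c}$ is well defined from $A$ to $B$ if $e^{zE^r_c}f\in B$ for every $f\in A$; it is discontinuous from $A$ to $B$ if its restriction to the domain $\{f\in A: e^{zE^r_c}f\in B\}$, with the topology of $A$, is not continuous into $B$. Theorem. Let $z,c\in\mathbb C$ with $\operatorname{Re}z>0$,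 let $r>0$, $\alpha_1>\frac1r$ and $\alpha_2\ge\frac1r$. Then $e^{zE^r_c}$ is discontinuous, and moreover not well defined, (i) from $\mathcal S(\mathbb R^d_+)$ to $\mathcal S'(\mathbb R^d_+)$; (ii) from $\mathcal G_{0,\alpha_1}$ to $\mathcal G'_{0,\alpha_1}$; (iii) from $\mathcal G_{\alpha_2}$ to $\mathcal G'_{\alpha_2}$. -/

import Mathlib

open scoped ContDiff

noncomputable section

namespace LaguerreOrthant

/-! ### The orthant, partial derivatives, Laguerre functions -/

/-- The open orthant `ℝ^d_+ = (0,∞)^d`. -/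
def orthant (d : ℕ) : Set (Fin d → ℝ) := {x | ∀ j, 0 < x j}

/-- The closed orthant `[0,∞)^d`. -/
def closedOrthant (d : ℕ) : Set (Fin d → ℝ) := {x | ∀ j, 0 ≤ x j}

/-- The monomial `x^β = x_1^{β_1} ⋯ x_d^{β_d}`. -/
def monom {d : ℕ} (β : Fin d → ℕ) (x : Fin d → ℝ) : ℝ := ∏ j, x j ^ β j

/-- The first order partial derivative `∂_i f`. -/
def partialDeriv {d : ℕ} (i : Fin d) (f : (Fin d → ℝ) → ℂ) : (Fin d → ℝ) → ℂ :=
  fun x => fderiv ℝ f x (Pi.single i 1)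

/-- The partial derivative `∂^α f = ∂_1^{α_1} ⋯ ∂_d^{α_d} f`. -/
def multiDeriv {d : ℕ} (α : Fin d → ℕ) (f : (Fin d → ℝ) → ℂ) : (Fin d → ℝ) → ℂ :=
  (List.finRange d).foldr (fun i g => (partialDeriv i)^[α i] g) f

/-- The Laguerre polynomial `L_n(x) = (e^x / n!) (d/dx)^n (e^{-x} x^n)` in one variable. -/
def laguerrePoly (n : ℕ) (x : ℝ) : ℝ :=
  Real.exp x / (n.factorial : ℝ) * iteratedDeriv n (fun t : ℝ => Real.exp (-t) * t ^ n) x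

/-- The Laguerre function `l_n(x) = ∏_j L_{n_j}(x_j) e^{-x_j/2}` in `d` variables. -/
def laguerreFun {d : ℕ} (n : Fin d → ℕ) (x : Fin d → ℝ) : ℝ :=
  ∏ j, laguerrePoly (n j) (x j) * Real.exp (-(x j) / 2)

lemma isOpen_orthant (d : ℕ) : IsOpen (orthant d) := by
  have : orthant d = ⋂ j : Fin d, {x | 0 < x j} := by ext; simp [orthant]
  rw [this]
  exact isOpen_iInter_of_finite fun j => isOpen_lt continuous_const (continuous_apply j)

lemma monom_nonneg {d : ℕ} (β : Fin d → ℕ) {x : Fin d → ℝ} (hx : x ∈ orthant d) :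
    0 ≤ monom β x :=
  Finset.prod_nonneg fun j _ => pow_nonneg (hx j).le _

/-- A property of functions that is inherited by partial derivatives is inherited by `∂^α`. -/
lemma multiDeriv_induction {d : ℕ} (P : ((Fin d → ℝ) → ℂ) → Prop)
    (hP : ∀ i f, P f → P (partialDeriv i f)) (α : Fin d → ℕ) {f : (Fin d → ℝ) → ℂ} (hf : P f) :
    P (multiDeriv α f) := by
  unfold multiDeriv
  induction List.finRange d with
  | nil => exact hf
  | cons i L ih =>
    simp only [List.foldr_cons]
    generalize α i = k
    induction k with
    | zero => exact ih
    | succ k ihk => rw [Function.iterate_succ_apply']; exact hP _ _ ihk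

/-- A relation between functions that is inherited by partial derivatives is inherited
by `∂^α`. -/
lemma multiDeriv_induction₂ {d : ℕ} (P : ((Fin d → ℝ) → ℂ) → ((Fin d → ℝ) → ℂ) → Prop)
    (hP : ∀ i f g, P f g → P (partialDeriv i f) (partialDeriv i g)) (α : Fin d → ℕ)
    {f g : (Fin d → ℝ) → ℂ} (h : P f g) : P (multiDeriv α f) (multiDeriv α g) := by
  unfold multiDeriv
  induction List.finRange d with
  | nil => exact h
  | cons i L ih =>
    simp only [List.foldr_cons]
    generalize α i = k
    induction k with
    | zero => exact ih
    | succ k ihk => simp only [Function.iterate_succ_apply']; exact hP _ _ _ ihk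

lemma partialDeriv_congr {d : ℕ} {f g : (Fin d → ℝ) → ℂ} (h : Set.EqOn f g (orthant d))
    (i : Fin d) : Set.EqOn (partialDeriv i f) (partialDeriv i g) (orthant d) := by
  intro x hx
  have : f =ᶠ[nhds x] g := Filter.eventuallyEq_of_mem ((isOpen_orthant d).mem_nhds hx) h
  simp only [partialDeriv, this.fderiv_eq]

lemma multiDeriv_congr {d : ℕ} {f g : (Fin d → ℝ) → ℂ} (h : Set.EqOn f g (orthant d))
    (α : Fin d → ℕ) : Set.EqOn (multiDeriv α f) (multiDeriv α g) (orthant d) :=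
  multiDeriv_induction₂ (fun f g => Set.EqOn f g (orthant d))
    (fun i _ _ h => partialDeriv_congr h i) α h

lemma contDiffOn_partialDeriv {d : ℕ} {f : (Fin d → ℝ) → ℂ} (hf : ContDiffOn ℝ ∞ f (orthant d))
    (i : Fin d) : ContDiffOn ℝ ∞ (partialDeriv i f) (orthant d) :=
  (hf.fderiv_of_isOpen (isOpen_orthant d) (m := ∞) (by simp)).clm_apply contDiffOn_const

lemma partialDeriv_add {d : ℕ} {f g : (Fin d → ℝ) → ℂ} (hf : ContDiffOn ℝ ∞ f (orthant d))
    (hg : ContDiffOn ℝ ∞ g (orthant d)) (i : Fin d) :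
    Set.EqOn (partialDeriv i (f + g)) (partialDeriv i f + partialDeriv i g) (orthant d) := by
  intro x hx
  have hU := (isOpen_orthant d).mem_nhds hx
  have h1 : DifferentiableAt ℝ f x := (hf.contDiffAt hU).differentiableAt (by simp)
  have h2 : DifferentiableAt ℝ g x := (hg.contDiffAt hU).differentiableAt (by simp)
  simp [partialDeriv, fderiv_add h1 h2]

lemma partialDeriv_smul {d : ℕ} {f : (Fin d → ℝ) → ℂ} (hf : ContDiffOn ℝ ∞ f (orthant d))
    (a : ℂ) (i : Fin d) :
    Set.EqOn (partialDeriv i (a • f)) (a • partialDeriv i f) (orthant d) := by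
  intro x hx
  have hU := (isOpen_orthant d).mem_nhds hx
  have h1 : DifferentiableAt ℝ f x := (hf.contDiffAt hU).differentiableAt (by simp)
  simp [partialDeriv, fderiv_const_smul h1 a]

lemma multiDeriv_smul {d : ℕ} {f : (Fin d → ℝ) → ℂ} (hf : ContDiffOn ℝ ∞ f (orthant d))
    (a : ℂ) (α : Fin d → ℕ) :
    Set.EqOn (multiDeriv α (a • f)) (a • multiDeriv α f) (orthant d) := by
  refine (multiDeriv_induction₂ (fun F G => ContDiffOn ℝ ∞ G (orthant d) ∧
    Set.EqOn F (a • G) (orthant d)) ?_ α ⟨hf, fun _ _ => rfl⟩).2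
  rintro i F G ⟨hG, h⟩
  exact ⟨contDiffOn_partialDeriv hG i, (partialDeriv_congr h i).trans (partialDeriv_smul hG a i)⟩

lemma multiDeriv_add {d : ℕ} {f g : (Fin d → ℝ) → ℂ} (hf : ContDiffOn ℝ ∞ f (orthant d))
    (hg : ContDiffOn ℝ ∞ g (orthant d)) (α : Fin d → ℕ) :
    Set.EqOn (multiDeriv α (f + g)) (multiDeriv α f + multiDeriv α g) (orthant d) := by
  unfold multiDeriv
  have key : ∀ L : List (Fin d),
      ContDiffOn ℝ ∞ (L.foldr (fun i h => (partialDeriv i)^[α i] h) f) (orthant d) ∧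
      ContDiffOn ℝ ∞ (L.foldr (fun i h => (partialDeriv i)^[α i] h) g) (orthant d) ∧
      Set.EqOn (L.foldr (fun i h => (partialDeriv i)^[α i] h) (f + g))
        (L.foldr (fun i h => (partialDeriv i)^[α i] h) f +
          L.foldr (fun i h => (partialDeriv i)^[α i] h) g) (orthant d) := by
    intro L
    induction L with
    | nil => exact ⟨hf, hg, fun _ _ => rfl⟩
    | cons i L ih =>
      simp only [List.foldr_cons]
      generalize α i = k
      induction k with
      | zero => exact ih
      | succ k ihk =>
        obtain ⟨h1, h2, h3⟩ := ihk
        simp only [Function.iterate_succ_apply']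
        exact ⟨contDiffOn_partialDeriv h1 i, contDiffOn_partialDeriv h2 i,
          (partialDeriv_congr h3 i).trans (partialDeriv_add h1 h2 i)⟩
  exact (key _).2.2

/-! ### The Schwartz space on the orthant and its strong dual -/

/-- Membership in `𝒮(ℝ^d_+)`. A function on the orthant is represented by its extension by `0`
to `ℝ^d`, so that equality of representatives is equality on the orthant. -/
structure IsSchwartz {d : ℕ} (f : (Fin d → ℝ) → ℂ) : Prop where
  zero_off : ∀ x ∉ orthant d, f x = 0
  smooth : ContDiffOn ℝ ∞ f (orthant d)
  extends_cont : ∀ α : Fin d → ℕ, ∃ g : (Fin d → ℝ) → ℂ,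
    ContinuousOn g (closedOrthant d) ∧ Set.EqOn g (multiDeriv α f) (orthant d)
  decay : ∀ α β : Fin d → ℕ,
    BddAbove (Set.range fun x : orthant d => monom β x.1 * ‖multiDeriv α f x.1‖)

lemma IsSchwartz.add {d : ℕ} {f g : (Fin d → ℝ) → ℂ} (hf : IsSchwartz f) (hg : IsSchwartz g) :
    IsSchwartz (f + g) where
  zero_off x hx := by simp [hf.zero_off x hx, hg.zero_off x hx]
  smooth := hf.smooth.add hg.smooth
  extends_cont α := by
    obtain ⟨F, hF, hF'⟩ := hf.extends_cont α
    obtain ⟨G, hG, hG'⟩ := hg.extends_cont α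
    refine ⟨F + G, hF.add hG, fun x hx => ?_⟩
    rw [multiDeriv_add hf.smooth hg.smooth α hx, Pi.add_apply, Pi.add_apply, hF' hx, hG' hx]
  decay α β := by
    obtain ⟨A, hA⟩ := hf.decay α β
    obtain ⟨B, hB⟩ := hg.decay α β
    refine ⟨A + B, ?_⟩
    rintro _ ⟨x, rfl⟩
    have h1 := hA ⟨x, rfl⟩
    have h2 := hB ⟨x, rfl⟩
    have h3 := monom_nonneg β x.2
    simp only [multiDeriv_add hf.smooth hg.smooth α x.2, Pi.add_apply] at *
    calc _ ≤ monom β x.1 * (‖multiDeriv α f x.1‖ + ‖multiDeriv α g x.1‖) := by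
          gcongr; exact norm_add_le _ _
      _ ≤ A + B := by rw [mul_add]; exact add_le_add h1 h2

lemma IsSchwartz.smul {d : ℕ} {f : (Fin d → ℝ) → ℂ} (hf : IsSchwartz f) (a : ℂ) :
    IsSchwartz (a • f) where
  zero_off x hx := by simp [hf.zero_off x hx]
  smooth := hf.smooth.const_smul a
  extends_cont α := by
    obtain ⟨F, hF, hF'⟩ := hf.extends_cont α
    refine ⟨a • F, hF.const_smul a, fun x hx => ?_⟩
    rw [multiDeriv_smul hf.smooth a α hx, Pi.smul_apply, Pi.smul_apply, hF' hx]
  decay α β := by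
    obtain ⟨A, hA⟩ := hf.decay α β
    refine ⟨‖a‖ * A, ?_⟩
    rintro _ ⟨x, rfl⟩
    have h1 : monom β x.1 * ‖multiDeriv α f x.1‖ ≤ A := hA ⟨x, rfl⟩
    simp only [multiDeriv_smul hf.smooth a α x.2, Pi.smul_apply, norm_smul]
    calc _ = ‖a‖ * (monom β x.1 * ‖multiDeriv α f x.1‖) := by ring
      _ ≤ ‖a‖ * A := by gcongr

lemma IsSchwartz.zero {d : ℕ} : IsSchwartz (0 : (Fin d → ℝ) → ℂ) := by
  have h : ∀ α : Fin d → ℕ, Set.EqOn (multiDeriv α (0 : (Fin d → ℝ) → ℂ)) 0 (orthant d) := by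
    intro α
    have := multiDeriv_smul (d := d) (f := 0) contDiffOn_const (0 : ℂ) α
    simpa using this
  refine ⟨fun _ _ => rfl, contDiffOn_const, fun α => ⟨0, continuousOn_const, (h α).symm⟩,
    fun α β => ⟨0, ?_⟩⟩
  rintro _ ⟨x, rfl⟩
  simp [h α x.2]

/-- The functions in `𝒮(ℝ^d_+)`, as a vector space. -/
def schwartzSubmodule (d : ℕ) : Submodule ℂ ((Fin d → ℝ) → ℂ) where
  carrier := {f | IsSchwartz f}
  add_mem' := IsSchwartz.add
  zero_mem' := IsSchwartz.zero
  smul_mem' a _ hf := hf.smul a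

/-- The space `𝒮(ℝ^d_+)`. -/
def SchwartzOrthant (d : ℕ) : Type := schwartzSubmodule d

instance (d : ℕ) : AddCommGroup (SchwartzOrthant d) :=
  inferInstanceAs (AddCommGroup (schwartzSubmodule d))

instance (d : ℕ) : Module ℂ (SchwartzOrthant d) :=
  inferInstanceAs (Module ℂ (schwartzSubmodule d))

/-- The underlying function of an element of `𝒮(ℝ^d_+)`. -/
def SchwartzOrthant.toFun {d : ℕ} (f : SchwartzOrthant d) : (Fin d → ℝ) → ℂ := f.1

/-- The seminorm `μ_{α,β}(f) = sup_{x ∈ ℝ^d_+} x^β |∂^α f(x)|`. -/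
def schwartzSeminorm (d : ℕ) (αβ : (Fin d → ℕ) × (Fin d → ℕ)) : Seminorm ℂ (SchwartzOrthant d) :=
  Seminorm.of
    (fun f => ⨆ x : orthant d, monom αβ.2 x.1 * ‖multiDeriv αβ.1 f.toFun x.1‖)
    (by
      intro f g
      have : Nonempty (orthant d) := ⟨⟨fun _ => 1, fun _ => one_pos⟩⟩
      refine ciSup_le fun x => ?_
      have h1 := le_ciSup (f.2.decay αβ.1 αβ.2) x
      have h2 := le_ciSup (g.2.decay αβ.1 αβ.2) x
      have h3 := monom_nonneg αβ.2 x.2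
      have h4 : multiDeriv αβ.1 (f + g).toFun x.1 =
          multiDeriv αβ.1 f.toFun x.1 + multiDeriv αβ.1 g.toFun x.1 :=
        multiDeriv_add f.2.smooth g.2.smooth αβ.1 x.2
      rw [h4]
      calc _ ≤ monom αβ.2 x.1 * (‖multiDeriv αβ.1 f.toFun x.1‖ + ‖multiDeriv αβ.1 g.toFun x.1‖) := by
            gcongr; exact norm_add_le _ _
        _ ≤ _ := by rw [mul_add]; exact add_le_add h1 h2)
    (by
      intro a f
      rw [Real.mul_iSup_of_nonneg (norm_nonneg a)]
      refine iSup_congr fun x => ?_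
      have h4 : multiDeriv αβ.1 (a • f).toFun x.1 = a • multiDeriv αβ.1 f.toFun x.1 :=
        multiDeriv_smul f.2.smooth a αβ.1 x.2
      rw [h4, norm_smul]; ring)

/-- The Fréchet topology of `𝒮(ℝ^d_+)`, generated by the seminorms `μ_{α,β}`. -/
instance (d : ℕ) : TopologicalSpace (SchwartzOrthant d) :=
  (SeminormFamily.moduleFilterBasis (𝕜 := ℂ) (schwartzSeminorm d)).topology

/-- The space `𝒮'(ℝ^d_+)` of continuous linear functionals on `𝒮(ℝ^d_+)`. It carries the
topology of uniform convergence on bounded sets, that is, the strong dual topology. -/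
abbrev TemperedOrthant (d : ℕ) : Type := SchwartzOrthant d →L[ℂ] ℂ

/-! ### The Laguerre functions belong to the Schwartz space -/

lemma exists_iteratedDeriv_exp_poly (P : Polynomial ℝ) (k : ℕ) :
    ∃ Q : Polynomial ℝ, ∀ x : ℝ,
      iteratedDeriv k (fun t : ℝ => Real.exp (-t) * P.eval t) x = Real.exp (-x) * Q.eval x := by
  induction k with
  | zero => exact ⟨P, fun x => by simp⟩
  | succ k ih =>
    obtain ⟨Q, hQ⟩ := ih
    refine ⟨Polynomial.derivative Q - Q, fun x => ?_⟩
    rw [iteratedDeriv_succ, funext hQ]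
    have h1 : HasDerivAt (fun t : ℝ => Real.exp (-t)) (Real.exp (-x) * (-1)) x :=
      (hasDerivAt_neg x).exp
    rw [HasDerivAt.deriv (f := fun t : ℝ => Real.exp (-t) * Q.eval t) (h1.mul (Q.hasDerivAt x))]
    simp only [Polynomial.eval_sub]
    ring

lemma exists_laguerrePoly_eq (n : ℕ) :
    ∃ P : Polynomial ℝ, ∀ x : ℝ, laguerrePoly n x = P.eval x := by
  obtain ⟨Q, hQ⟩ := exists_iteratedDeriv_exp_poly (Polynomial.X ^ n) n
  refine ⟨Polynomial.C ((n.factorial : ℝ)⁻¹) * Q, fun x => ?_⟩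
  have h := hQ x
  simp only [Polynomial.eval_pow, Polynomial.eval_X] at h
  rw [laguerrePoly, h, Polynomial.eval_mul, Polynomial.eval_C, Real.exp_neg]
  have := Real.exp_ne_zero x
  field_simp

/-- Polynomials times `e^{-(x_1 + ⋯ + x_d)/2}`. -/
def polyExp {d : ℕ} (P : MvPolynomial (Fin d) ℝ) (x : Fin d → ℝ) : ℂ :=
  ((MvPolynomial.eval x P * Real.exp (-(∑ j, x j) / 2) : ℝ) : ℂ)

lemma hasFDerivAt_mvPolynomial {d : ℕ} (P : MvPolynomial (Fin d) ℝ) (x : Fin d → ℝ) :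
    HasFDerivAt (fun y : Fin d → ℝ => MvPolynomial.eval y P)
      (∑ i, MvPolynomial.eval x (MvPolynomial.pderiv i P) •
        (ContinuousLinearMap.proj i : (Fin d → ℝ) →L[ℝ] ℝ)) x := by
  induction P using MvPolynomial.induction_on with
  | C a => simpa using hasFDerivAt_const a x
  | add p q hp hq =>
    simp only [map_add, add_smul, Finset.sum_add_distrib]
    exact hp.add hq
  | mul_X p k hp =>
    simp only [map_mul, MvPolynomial.eval_X]
    have h2 : HasFDerivAt (fun y : Fin d → ℝ => y k)
      (ContinuousLinearMap.proj k : (Fin d → ℝ) →L[ℝ] ℝ) x := hasFDerivAt_apply k x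
    have h3 : HasFDerivAt (fun y : Fin d → ℝ => MvPolynomial.eval y p * y k) _ x := hp.mul h2
    refine h3.congr_fderiv ?_
    ext v
    simp [MvPolynomial.pderiv_X, Pi.single_apply, apply_ite, add_mul, Finset.sum_add_distrib,
      Finset.mul_sum, mul_assoc]

lemma partialDeriv_polyExp {d : ℕ} (P : MvPolynomial (Fin d) ℝ) (i : Fin d) :
    ∃ Q : MvPolynomial (Fin d) ℝ, partialDeriv i (polyExp P) = polyExp Q := by
  refine ⟨MvPolynomial.pderiv i P - MvPolynomial.C (1 / 2) * P, funext fun x => ?_⟩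
  have hs : HasFDerivAt (fun y : Fin d → ℝ => -(∑ j, y j) / 2)
      (-(2⁻¹ : ℝ) • ∑ j, (ContinuousLinearMap.proj j : (Fin d → ℝ) →L[ℝ] ℝ)) x := by
    have h0 : HasFDerivAt (fun y : Fin d → ℝ => ∑ j, y j)
        (∑ j, (ContinuousLinearMap.proj j : (Fin d → ℝ) →L[ℝ] ℝ)) x :=
      HasFDerivAt.fun_sum fun j _ => hasFDerivAt_apply j x
    have h1 := h0.const_mul (-(2⁻¹ : ℝ))
    have h2 : (fun y : Fin d → ℝ => -(∑ j, y j) / 2) = fun y => -(2⁻¹ : ℝ) * ∑ j, y j := by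
      ext y; ring
    rw [h2]
    exact h1
  have h := Complex.ofRealCLM.hasFDerivAt.comp x ((hasFDerivAt_mvPolynomial P x).mul hs.exp)
  have h' : fderiv ℝ (polyExp P) x = _ := h.fderiv
  rw [partialDeriv, h']
  simp [polyExp, Pi.single_apply]
  ring

lemma multiDeriv_polyExp {d : ℕ} (P : MvPolynomial (Fin d) ℝ) (α : Fin d → ℕ) :
    ∃ Q : MvPolynomial (Fin d) ℝ, multiDeriv α (polyExp P) = polyExp Q :=
  multiDeriv_induction (fun f => ∃ Q : MvPolynomial (Fin d) ℝ, f = polyExp Q)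
    (by rintro i _ ⟨Q, rfl⟩; exact partialDeriv_polyExp Q i) α ⟨P, rfl⟩

lemma contDiff_mvPolynomial {d : ℕ} (P : MvPolynomial (Fin d) ℝ) :
    ContDiff ℝ ∞ (fun y : Fin d → ℝ => MvPolynomial.eval y P) := by
  induction P using MvPolynomial.induction_on with
  | C a => simpa using contDiff_const
  | add p q hp hq => simpa using hp.add hq
  | mul_X p k hp => simpa using hp.mul (contDiff_apply ℝ ℝ k)

lemma contDiff_polyExp {d : ℕ} (P : MvPolynomial (Fin d) ℝ) :
    ContDiff ℝ ∞ (polyExp P) := by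
  refine Complex.ofRealCLM.contDiff.comp ((contDiff_mvPolynomial P).mul ?_)
  exact Real.contDiff_exp.comp
    ((ContDiff.sum fun j _ => contDiff_apply ℝ ℝ j).neg.div_const 2)

lemma bddAbove_polyExp {d : ℕ} (P : MvPolynomial (Fin d) ℝ) :
    ∃ C, ∀ x ∈ orthant d, ‖polyExp P x‖ ≤ C := by
  induction P using MvPolynomial.induction_on' with
  | add p q hp hq =>
    obtain ⟨A, hA⟩ := hp
    obtain ⟨B, hB⟩ := hq
    refine ⟨A + B, fun x hx => ?_⟩
    have : polyExp (p + q) x = polyExp p x + polyExp q x := by simp [polyExp, add_mul]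
    rw [this]
    exact (norm_add_le _ _).trans (add_le_add (hA x hx) (hB x hx))
  | monomial m a =>
    refine ⟨|a| * ∏ j, ((m j).factorial * 2 ^ m j : ℝ), fun x hx => ?_⟩
    have h1 : polyExp (MvPolynomial.monomial m a) x =
        ((a * ∏ j, (x j ^ m j * Real.exp (-(x j) / 2)) : ℝ) : ℂ) := by
      rw [polyExp, MvPolynomial.eval_monomial, Finset.prod_mul_distrib, ← Real.exp_sum,
        Finsupp.prod_fintype _ _ (by simp), ← Finset.sum_div, Finset.sum_neg_distrib, mul_assoc]
    rw [h1, Complex.norm_real, Real.norm_eq_abs, abs_mul, Finset.abs_prod]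
    gcongr with j hj
    have hxj : 0 ≤ x j / 2 := by have := hx j; positivity
    rw [abs_of_nonneg (mul_nonneg (pow_nonneg (hx j).le _) (Real.exp_pos _).le)]
    have h2 := Real.pow_div_factorial_le_exp (x j / 2) hxj (m j)
    rw [div_pow, div_div, div_le_iff₀ (by positivity)] at h2
    rw [neg_div, Real.exp_neg, ← div_eq_mul_inv, div_le_iff₀ (Real.exp_pos _)]
    linarith

/-- Zero extensions of polynomials times `e^{-(x_1 + ⋯ + x_d)/2}` belong to `𝒮(ℝ^d_+)`. -/
lemma isSchwartz_polyExp {d : ℕ} (P : MvPolynomial (Fin d) ℝ) :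
    IsSchwartz ((orthant d).indicator (polyExp P)) := by
  have he : Set.EqOn ((orthant d).indicator (polyExp P)) (polyExp P) (orthant d) :=
    fun x hx => Set.indicator_of_mem hx _
  refine ⟨fun x hx => Set.indicator_of_notMem hx _,
    (contDiff_polyExp P).contDiffOn.congr he, fun α => ?_, fun α β => ?_⟩
  · obtain ⟨Q, hQ⟩ := multiDeriv_polyExp P α
    refine ⟨polyExp Q, (contDiff_polyExp Q).continuous.continuousOn, fun x hx => ?_⟩
    rw [multiDeriv_congr he α hx, hQ]
  · obtain ⟨Q, hQ⟩ := multiDeriv_polyExp P α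
    obtain ⟨C, hC⟩ := bddAbove_polyExp ((∏ j, MvPolynomial.X j ^ β j) * Q)
    refine ⟨C, ?_⟩
    rintro _ ⟨x, rfl⟩
    have h := hC x.1 x.2
    have h2 : polyExp ((∏ j, MvPolynomial.X j ^ β j) * Q) x.1 = (monom β x.1 : ℂ) * polyExp Q x.1 := by
      simp [polyExp, monom, mul_assoc]
    rw [h2, norm_mul, Complex.norm_real, Real.norm_of_nonneg (monom_nonneg β x.2)] at h
    simpa only [multiDeriv_congr he α x.2, hQ] using h

lemma exists_laguerreFun_eq {d : ℕ} (n : Fin d → ℕ) :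
    ∃ P : MvPolynomial (Fin d) ℝ, ∀ x, (laguerreFun n x : ℂ) = polyExp P x := by
  choose P hP using exists_laguerrePoly_eq
  refine ⟨∏ j, Polynomial.aeval (MvPolynomial.X j) (P (n j)), fun x => ?_⟩
  have h : ∀ j, MvPolynomial.eval x (Polynomial.aeval (MvPolynomial.X j) (P (n j))) =
      (P (n j)).eval (x j) := by
    intro j
    have := Polynomial.aeval_algHom_apply (MvPolynomial.aeval (R := ℝ) x)
      (MvPolynomial.X j) (P (n j))
    simpa [MvPolynomial.coe_aeval_eq_eval, Polynomial.coe_aeval_eq_eval] using this.symm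
  rw [polyExp, laguerreFun, Finset.prod_mul_distrib, ← Real.exp_sum, map_prod, ← Finset.sum_div,
    Finset.sum_neg_distrib]
  simp only [h, hP]

/-- The Laguerre function `l_n` as an element of `𝒮(ℝ^d_+)`. -/
def laguerreSchwartz {d : ℕ} (n : Fin d → ℕ) : SchwartzOrthant d :=
  ⟨(orthant d).indicator fun x => (laguerreFun n x : ℂ), by
    obtain ⟨P, hP⟩ := exists_laguerreFun_eq n
    rw [show (fun x => (laguerreFun n x : ℂ)) = polyExp P from funext hP]
    exact isSchwartz_polyExp P⟩

/-! ### Formal Laguerre series -/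

/-- The space `𝒢'_0(ℝ^d_+)` of all formal Laguerre series `∑ a_n l_n`, `n ∈ ℕ_0^d`, each given by
its family of coefficients. -/
def FormalSeries (d : ℕ) : Type := (Fin d → ℕ) → ℂ

instance (d : ℕ) : AddCommGroup (FormalSeries d) :=
  inferInstanceAs (AddCommGroup ((Fin d → ℕ) → ℂ))

instance (d : ℕ) : Module ℂ (FormalSeries d) :=
  inferInstanceAs (Module ℂ ((Fin d → ℕ) → ℂ))

/-- The length `|n| = n_1 + ⋯ + n_d`. -/
def len {d : ℕ} (n : Fin d → ℕ) : ℕ := ∑ j, n j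

/-- The operator `e^{z E_c^r}` on formal Laguerre series,
`∑ a_n l_n ↦ ∑ e^{z (|n| + c)^r} a_n l_n`, with the principal branch of the power and `0^r = 0`. -/
def propagator {d : ℕ} (z c : ℂ) (r : ℝ) (a : FormalSeries d) : FormalSeries d :=
  fun n => Complex.exp (z * ((len n : ℂ) + c) ^ (r : ℂ)) * a n

/-- The Laguerre expansion of `f ∈ 𝒮(ℝ^d_+)`: the coefficients are
`a_n(f) = ∫_{ℝ^d_+} f(x) l_n(x) dx`. -/
def schwartzCoeff {d : ℕ} (f : SchwartzOrthant d) : FormalSeries d :=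
  fun n => ∫ x in orthant d, f.toFun x * (laguerreFun n x : ℂ)

/-- The Laguerre expansion of `T ∈ 𝒮'(ℝ^d_+)`: the coefficients are `a_n(T) = ⟨T, l_n⟩`. -/
def temperedCoeff {d : ℕ} (T : TemperedOrthant d) : FormalSeries d :=
  fun n => T (laguerreSchwartz n)

/-! ### The spaces `𝒢_α`, `𝒢_{0,α}`, `𝒢'_α`, `𝒢'_{0,α}` -/

/-- The norm `sup_n |a_n| e^{h |n|^{1/α}}`, where `h` may have either sign. -/
def stepNorm {d : ℕ} (α h : ℝ) (a : FormalSeries d) : ℝ :=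
  ⨆ n : Fin d → ℕ, ‖a n‖ * Real.exp (h * (len n : ℝ) ^ (1 / α))

/-- The Banach space of all formal series with `sup_n |a_n| e^{h |n|^{1/α}} < ∞`. For `h > 0` this
is `𝒢_{α,h}`; with `-h` in place of `h` it is `𝒢'_{α,h}`. -/
def step (d : ℕ) (α h : ℝ) : Submodule ℂ (FormalSeries d) where
  carrier := {a | BddAbove (Set.range fun n => ‖a n‖ * Real.exp (h * (len n : ℝ) ^ (1 / α)))}
  add_mem' := by
    rintro a b ⟨A, hA⟩ ⟨B, hB⟩
    refine ⟨A + B, ?_⟩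
    rintro _ ⟨n, rfl⟩
    have h1 := hA ⟨n, rfl⟩
    have h2 := hB ⟨n, rfl⟩
    calc ‖a n + b n‖ * _ ≤ (‖a n‖ + ‖b n‖) * _ := by gcongr; exact norm_add_le _ _
      _ ≤ A + B := by rw [add_mul]; exact add_le_add h1 h2
  zero_mem' := by
    refine ⟨0, ?_⟩
    rintro _ ⟨n, rfl⟩
    change ‖(0 : ℂ)‖ * _ ≤ 0
    simp
  smul_mem' := by
    rintro c a ⟨A, hA⟩
    refine ⟨‖c‖ * A, ?_⟩
    rintro _ ⟨n, rfl⟩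
    have h1 : _ ≤ A := hA ⟨n, rfl⟩
    change ‖c * a n‖ * _ ≤ _
    rw [norm_mul, mul_assoc]
    exact mul_le_mul_of_nonneg_left h1 (norm_nonneg c)

lemma step_anti (d : ℕ) (α : ℝ) {h h' : ℝ} (hh : h' ≤ h) : step d α h ≤ step d α h' := by
  rintro a ⟨A, hA⟩
  refine ⟨A, ?_⟩
  rintro _ ⟨n, rfl⟩
  refine le_trans ?_ (hA ⟨n, rfl⟩)
  have h0 : (0 : ℝ) ≤ (len n : ℝ) ^ (1 / α) := by positivity
  exact mul_le_mul_of_nonneg_left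
    (Real.exp_le_exp.2 (mul_le_mul_of_nonneg_right hh h0)) (norm_nonneg _)

/-- `𝒢_α(ℝ^d_+) = ⋃_{h>0} 𝒢_{α,h}`. -/
def GSpace (d : ℕ) (α : ℝ) : Submodule ℂ (FormalSeries d) where
  carrier := {a | ∃ h : ℝ, 0 < h ∧ a ∈ step d α h}
  add_mem' := by
    rintro a b ⟨h, hh, ha⟩ ⟨k, hk, hb⟩
    exact ⟨min h k, lt_min hh hk, add_mem (step_anti d α (min_le_left _ _) ha)
      (step_anti d α (min_le_right _ _) hb)⟩
  zero_mem' := ⟨1, one_pos, zero_mem _⟩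
  smul_mem' := by
    rintro c a ⟨h, hh, ha⟩
    exact ⟨h, hh, Submodule.smul_mem _ c ha⟩

/-- `𝒢_{0,α}(ℝ^d_+) = ⋂_{h>0} 𝒢_{α,h}`. -/
def GZeroSpace (d : ℕ) (α : ℝ) : Submodule ℂ (FormalSeries d) where
  carrier := {a | ∀ h : ℝ, 0 < h → a ∈ step d α h}
  add_mem' ha hb h hh := add_mem (ha h hh) (hb h hh)
  zero_mem' _ _ := zero_mem _
  smul_mem' c _ ha h hh := Submodule.smul_mem _ c (ha h hh)

/-- `𝒢'_α(ℝ^d_+) = ⋂_{h>0} 𝒢'_{α,h}`. -/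
def GDual (d : ℕ) (α : ℝ) : Submodule ℂ (FormalSeries d) where
  carrier := {a | ∀ h : ℝ, 0 < h → a ∈ step d α (-h)}
  add_mem' ha hb h hh := add_mem (ha h hh) (hb h hh)
  zero_mem' _ _ := zero_mem _
  smul_mem' c _ ha h hh := Submodule.smul_mem _ c (ha h hh)

/-- `𝒢'_{0,α}(ℝ^d_+) = ⋃_{h>0} 𝒢'_{α,h}`. -/
def GZeroDual (d : ℕ) (α : ℝ) : Submodule ℂ (FormalSeries d) where
  carrier := {a | ∃ h : ℝ, 0 < h ∧ a ∈ step d α (-h)}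
  add_mem' := by
    rintro a b ⟨h, hh, ha⟩ ⟨k, hk, hb⟩
    exact ⟨max h k, lt_max_of_lt_left hh,
      add_mem (step_anti d α (neg_le_neg (le_max_left _ _)) ha)
        (step_anti d α (neg_le_neg (le_max_right _ _)) hb)⟩
  zero_mem' := ⟨1, one_pos, zero_mem _⟩
  smul_mem' := by
    rintro c a ⟨h, hh, ha⟩
    exact ⟨h, hh, Submodule.smul_mem _ c ha⟩

/-- The norm of a step as a seminorm on a space of formal series contained in that step. -/
def stepSeminorm {d : ℕ} (V : Submodule ℂ (FormalSeries d)) (α h : ℝ) (hV : V ≤ step d α h) :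
    Seminorm ℂ V :=
  Seminorm.of (fun a => stepNorm α h a.1)
    (by
      intro a b
      refine ciSup_le fun n => ?_
      have h1 := le_ciSup (hV a.2) n
      have h2 := le_ciSup (hV b.2) n
      calc ‖a.1 n + b.1 n‖ * _ ≤ (‖a.1 n‖ + ‖b.1 n‖) * _ := by gcongr; exact norm_add_le _ _
        _ ≤ _ := by rw [add_mul]; exact add_le_add h1 h2)
    (by
      intro c a
      simp only [stepNorm]
      rw [Real.mul_iSup_of_nonneg (norm_nonneg c)]
      refine iSup_congr fun n => ?_
      change ‖c * a.1 n‖ * _ = _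
      rw [norm_mul, mul_assoc])

/-- The locally convex inductive limit topology on `V` with respect to those steps (with parameter
in `H`) that are contained in `V`: it is generated by all seminorms on `V` whose restriction to
each step is continuous, that is, bounded by a multiple of the norm of the step. -/
@[reducible]
def inductiveTopology {d : ℕ} (V : Submodule ℂ (FormalSeries d)) (α : ℝ) (H : Set ℝ) :
    TopologicalSpace V :=
  (SeminormFamily.moduleFilterBasis (𝕜 := ℂ)
    (fun p : {p : Seminorm ℂ V // ∀ h ∈ H, ∃ C : ℝ, ∀ a : V, a.1 ∈ step d α h →
      p a ≤ C * stepNorm α h a.1} => p.1)).topology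

/-- The inductive limit topology of `𝒢_α`. -/
instance (d : ℕ) (α : ℝ) : TopologicalSpace (GSpace d α) :=
  inductiveTopology (GSpace d α) α {h | 0 < h}

/-- The inductive limit topology of `𝒢'_{0,α}`. -/
instance (d : ℕ) (α : ℝ) : TopologicalSpace (GZeroDual d α) :=
  inductiveTopology (GZeroDual d α) α {h | h < 0}

/-- The projective limit topology of `𝒢_{0,α}`. -/
instance (d : ℕ) (α : ℝ) : TopologicalSpace (GZeroSpace d α) :=
  (SeminormFamily.moduleFilterBasis (𝕜 := ℂ) (fun h : {h : ℝ // 0 < h} =>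
    stepSeminorm (GZeroSpace d α) α h.1 (fun _ ha => ha h.1 h.2))).topology

/-- The projective limit topology of `𝒢'_α`. -/
instance (d : ℕ) (α : ℝ) : TopologicalSpace (GDual d α) :=
  (SeminormFamily.moduleFilterBasis (𝕜 := ℂ) (fun h : {h : ℝ // 0 < h} =>
    stepSeminorm (GDual d α) α (-h.1) (fun _ ha => ha h.1 h.2))).topology

/-! ### Operators on formal series between two spaces -/

/-- `T` is well defined from `A` to `B`: it maps every element of `A` to an element of `B`. Here
`ιA` and `ιB` assign to the elements of `A` and `B` their formal Laguerre series. -/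
def WellDefined {d : ℕ} {A B : Type} (T : FormalSeries d → FormalSeries d)
    (ιA : A → FormalSeries d) (ιB : B → FormalSeries d) : Prop :=
  ∀ f : A, ∃ g : B, ιB g = T (ιA f)

/-- The maximal domain of `T` as an operator from `A` to `B`: all `f ∈ A` with `T f ∈ B`. -/
def maxDomain {d : ℕ} {A B : Type} (T : FormalSeries d → FormalSeries d)
    (ιA : A → FormalSeries d) (ιB : B → FormalSeries d) : Set A :=
  {f | ∃ g : B, ιB g = T (ιA f)}

/-- `T` is discontinuous as an operator from `A` to `B`: on its maximal domain, with the topology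
of `A`, it is not continuous into `B`. -/
def Discontinuous {d : ℕ} {A B : Type} [TopologicalSpace A] [TopologicalSpace B]
    (T : FormalSeries d → FormalSeries d) (ιA : A → FormalSeries d) (ιB : B → FormalSeries d) :
    Prop :=
  ∀ Φ : maxDomain T ιA ιB → B, (∀ f, ιB (Φ f) = T (ιA f.1)) → ¬ Continuous Φ

end LaguerreOrthant

end

noncomputable section

namespace LaguerreOrthant

open Polynomial

/-! ### Laguerre polynomials in one variable -/

/-! On the terms with $|n|=k$ the operator multiplies by $m_k=e^{z(k+c)^r}$, and since $(k+c)^r\sim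
k^r$, eventually $|m_k|\ge e^{\frac12\operatorname{Re}z\,k^r}$
(`eventually_exp_le_norm_multiplier`). In each case one picks a weight $w_k\to0$ that is small
enough for $A$ but with $|m_k|w_k^2\to\infty$: $w_k=e^{-k^{r/2}}$ in (i), $w_k=e^{-k^s}$ with
$1/\alpha_1<s<r$ in (ii), $w_k=e^{-\varepsilon k^{1/\alpha_2}}$ with
$\varepsilon=\operatorname{Re}z/8$ in (iii).

One factor $w_k$ serves as coefficient, the other as test. Along a coordinate axis $e$, the vectors
$w_kl_{ke}$ tend to $0$ in $A$ and lie in the maximal domain, while a test available in $B$ gives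
their images the size $|m_k|w_k^2$; so the images do not converge. A series in $A$ whose
coefficients on the axis are $w_k$ has an image on which the same test is unbounded, so the image is
not in $B$. In (ii) and (iii) the test is a weighted sup norm that is continuous on $B$
(`discontinuous_and_not_wellDefined_of_step`). In (i) it is evaluation on the bounded set
$\{w_kl_{ke}\}$.

Case (i) also needs analysis: the Schwartz seminorms of $l_{ke}$ must grow at most polynomially in
$k$, and the $l_n$ must be orthonormal. Both come from $l_k'=-\frac12l_k-\sum_{j<k}l_j$
(`lagFun_succ_eq_sum`), together with the three-term recurrence, which turns multiplication by $t$
into a combination of neighbouring indices. Hence $\sum w_kl_{ke}$ is a Schwartz function with the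
expected coefficients (`isSchwartz_axisSeries`, `schwartzCoeff_axisSchwartz`). -/

/-- The Laguerre polynomial `∑ (-1)^i (k choose i) / i! X^i`. -/
def lagPoly (k : ℕ) : ℝ[X] :=
  ∑ i ∈ Finset.range (k + 1), C ((-1) ^ i * (k.choose i : ℝ) / (i.factorial : ℝ)) * X ^ i

lemma coeff_lagPoly (k i : ℕ) :
    (lagPoly k).coeff i = (-1) ^ i * (k.choose i : ℝ) / (i.factorial : ℝ) := by
  simp only [lagPoly, finsetSum_coeff, coeff_C_mul, coeff_X_pow, mul_ite, mul_one, mul_zero,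
    Finset.sum_ite_eq, Finset.mem_range]
  split_ifs with h
  · rfl
  · rw [Nat.choose_eq_zero_of_lt (by omega)]; simp

/-- Leibniz's rule: the summand with $i$ derivatives on $e^{-t}$ and $k-i$ on $t^k$ yields the
monomial $x^i$. -/
lemma laguerrePoly_eq_eval (k : ℕ) (x : ℝ) : laguerrePoly k x = (lagPoly k).eval x := by
  have hexp : ∀ j : ℕ, iteratedDeriv j (fun t : ℝ => Real.exp (-t)) x =
      (-1) ^ j * Real.exp (-x) := by
    intro j
    have := iteratedDeriv_comp_neg j Real.exp x
    rw [this, iteratedDeriv_eq_iterate, Real.iter_deriv_exp, smul_eq_mul]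
  have h : iteratedDeriv k (fun t : ℝ => Real.exp (-t) * t ^ k) x = _ :=
    iteratedDeriv_mul (f := fun t : ℝ => Real.exp (-t)) (g := fun t : ℝ => t ^ k)
      (Real.contDiff_exp.comp contDiff_neg).contDiffAt (contDiff_id.pow k).contDiffAt
  have hpow : ∀ j : ℕ, iteratedDeriv j (fun t : ℝ => t ^ k) x =
      (k.descFactorial j : ℝ) * x ^ (k - j) := by
    intro j
    simp
  rw [laguerrePoly, h, lagPoly, eval_finsetSum, Finset.mul_sum]
  refine Finset.sum_congr rfl fun i hi => ?_
  have hi' : i ≤ k := by simpa [Nat.lt_succ_iff] using hi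
  rw [hexp, hpow, Nat.sub_sub_self hi']
  have h1 : (k.descFactorial (k - i) : ℝ) = k.factorial / i.factorial := by
    rw [eq_div_iff (by positivity)]
    have := Nat.factorial_mul_descFactorial (Nat.sub_le k i)
    rw [Nat.sub_sub_self hi'] at this
    rw [mul_comm]
    exact_mod_cast this
  rw [h1, Real.exp_neg]
  have := Real.exp_ne_zero x
  have h2 : (k.factorial : ℝ) ≠ 0 := by positivity
  simp only [eval_mul, eval_C, eval_pow, eval_X]
  field_simp

/-- Pascal's rule, coefficient by coefficient. All derivative formulas below rest on it. -/
lemma derivative_lagPoly_succ (k : ℕ) :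
    derivative (lagPoly (k + 1)) = derivative (lagPoly k) - lagPoly k := by
  ext i
  simp only [coeff_sub, coeff_derivative, coeff_lagPoly, Nat.choose_succ_succ, Nat.factorial_succ]
  push_cast
  have : (i.factorial : ℝ) ≠ 0 := by positivity
  have : (i + 1 : ℝ) ≠ 0 := by positivity
  field_simp
  ring

/-- The three-term recurrence, which lets a power of $t$ be traded for a power of the degree. Degree
zero has no lower neighbour and is treated in `mul_lagFun_zero`. -/
lemma X_mul_lagPoly_succ (k : ℕ) :
    X * lagPoly (k + 1) = C (2 * k + 3 : ℝ) * lagPoly (k + 1) - C (k + 2 : ℝ) * lagPoly (k + 2)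
      - C (k + 1 : ℝ) * lagPoly k := by
  ext i
  cases i with
  | zero =>
    simp only [mul_coeff_zero, coeff_X_zero, coeff_sub, coeff_lagPoly, zero_mul]
    simp
    ring
  | succ i =>
    have h1 : ((i : ℝ) + 1) * (k + 1).choose (i + 1) = (k + 1) * k.choose i := by
      have := Nat.add_one_mul_choose_eq k i
      rw [mul_comm ((i : ℝ) + 1)]
      exact_mod_cast this.symm
    have h2 : ((i : ℝ) + 1) * (k + 2).choose (i + 1) = (k + 2) * (k + 1).choose i := by
      have := Nat.add_one_mul_choose_eq (k + 1) i
      rw [mul_comm ((i : ℝ) + 1)]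
      exact_mod_cast this.symm
    simp only [coeff_X_mul, coeff_sub, coeff_C_mul, coeff_lagPoly, Nat.factorial_succ,
      Nat.choose_succ_succ] at h1 h2 ⊢
    push_cast at h1 h2 ⊢
    have : (i.factorial : ℝ) ≠ 0 := by positivity
    have : (i + 1 : ℝ) ≠ 0 := by positivity
    field_simp
    linear_combination (-1 : ℝ) ^ i * (h2 - h1)

/-- The polynomial factor of the `i`-th derivative of `L_k(t) e^{-t/2}`. -/
def lagDerivPoly (k i : ℕ) : ℝ[X] :=
  (fun P : ℝ[X] => derivative P - C (1 / 2) * P)^[i] (lagPoly k)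

/-- The `i`-th derivative of the Laguerre function `L_k(t) e^{-t/2}` in one variable. -/
def lagFun (k i : ℕ) (t : ℝ) : ℝ := (lagDerivPoly k i).eval t * Real.exp (-t / 2)

lemma laguerrePoly_mul_exp (k : ℕ) (t : ℝ) :
    laguerrePoly k t * Real.exp (-t / 2) = lagFun k 0 t := by
  rw [laguerrePoly_eq_eval]; rfl

lemma lagDerivPoly_succ (k i : ℕ) :
    lagDerivPoly k (i + 1) = derivative (lagDerivPoly k i) - C (1 / 2) * lagDerivPoly k i :=
  Function.iterate_succ_apply' _ _ _

lemma hasDerivAt_lagFun (k i : ℕ) (t : ℝ) : HasDerivAt (lagFun k i) (lagFun k (i + 1) t) t := by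
  have h1 : HasDerivAt (fun t : ℝ => Real.exp (-t / 2)) (Real.exp (-t / 2) * (-1 / 2)) t :=
    ((hasDerivAt_neg t).div_const 2).exp
  refine (((lagDerivPoly k i).hasDerivAt t).mul h1).congr_deriv ?_
  rw [lagFun, lagDerivPoly_succ]
  simp only [eval_sub, eval_mul, eval_C]
  ring

lemma continuous_lagFun (k i : ℕ) : Continuous (lagFun k i) :=
  continuous_iff_continuousAt.2 fun t => (hasDerivAt_lagFun k i t).continuousAt

/-- For $i=0$ this is `derivative_lagPoly_succ`; it persists for all $i$ because $P\mapsto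
P'-\frac12P$ is linear and commutes with differentiation. -/
lemma lagDerivPoly_succ_succ (k i : ℕ) :
    lagDerivPoly (k + 1) (i + 1) =
      lagDerivPoly k (i + 1) - C (1 / 2) * (lagDerivPoly (k + 1) i + lagDerivPoly k i) := by
  induction i with
  | zero =>
    simp only [lagDerivPoly_succ]
    simp only [lagDerivPoly, Function.iterate_zero, id, derivative_lagPoly_succ]
    have : (C (1 / 2) + C (1 / 2) : ℝ[X]) = 1 := by rw [← C_add]; norm_num
    linear_combination lagPoly k * this
  | succ i ih =>
    have hA := lagDerivPoly_succ (k + 1) i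
    have hB := lagDerivPoly_succ k i
    have hd := congrArg derivative ih
    simp only [derivative_sub, derivative_mul, derivative_C, derivative_add] at hd
    rw [lagDerivPoly_succ (k + 1) (i + 1), lagDerivPoly_succ k (i + 1)]
    linear_combination hd + C (1 / 2) * hA + C (1 / 2) * hB - C (1 / 2) * ih

lemma lagFun_succ_succ (k i : ℕ) (t : ℝ) :
    lagFun (k + 1) (i + 1) t = lagFun k (i + 1) t - (lagFun (k + 1) i t + lagFun k i t) / 2 := by
  simp only [lagFun, lagDerivPoly_succ_succ, eval_sub, eval_mul, eval_C, eval_add]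
  ring

lemma lagFun_zero_succ (i : ℕ) (t : ℝ) : lagFun 0 (i + 1) t = -lagFun 0 i t / 2 := by
  have h0 : ∀ i, ∃ a : ℝ, lagDerivPoly 0 i = C a := by
    intro i
    induction i with
    | zero => exact ⟨1, by simp [lagDerivPoly, lagPoly]⟩
    | succ i ih =>
      obtain ⟨a, ha⟩ := ih
      exact ⟨-(1 / 2 * a), by rw [lagDerivPoly_succ, ha]; simp⟩
  obtain ⟨a, ha⟩ := h0 i
  rw [lagFun, lagFun, lagDerivPoly_succ, ha]
  simp
  ring

/-- Telescoping of `lagFun_succ_succ`. A derivative costs only functions of no larger degree, which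
drives the pointwise bounds and the orthonormality. -/
lemma lagFun_succ_eq_sum (k i : ℕ) (t : ℝ) :
    lagFun k (i + 1) t = -lagFun k i t / 2 - ∑ j ∈ Finset.range k, lagFun j i t := by
  induction k with
  | zero => rw [lagFun_zero_succ]; simp
  | succ k ih => rw [lagFun_succ_succ, ih, Finset.sum_range_succ]; ring

lemma lagFun_apply_zero (k : ℕ) : lagFun k 0 0 = 1 := by
  have : (lagPoly k).eval 0 = 1 := by
    rw [← coeff_zero_eq_eval_zero, coeff_lagPoly]; simp
  simp [lagFun, lagDerivPoly, this]

lemma mul_lagFun_succ (k : ℕ) (t : ℝ) :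
    t * lagFun (k + 1) 0 t = (2 * k + 3) * lagFun (k + 1) 0 t - (k + 2) * lagFun (k + 2) 0 t
      - (k + 1) * lagFun k 0 t := by
  have := congrArg (eval t) (X_mul_lagPoly_succ k)
  simp only [eval_sub, eval_mul, eval_C, eval_X] at this
  simp only [lagFun, lagDerivPoly, Function.iterate_zero, id]
  linear_combination Real.exp (-t / 2) * this

lemma mul_lagFun_zero (t : ℝ) : t * lagFun 0 0 t = lagFun 0 0 t - lagFun 1 0 t := by
  simp [lagFun, lagDerivPoly, lagPoly, Finset.sum_range_succ]
  ring

/-! ### Bounds -/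

/-- By the derivative formula $(l_k^2)'=-l_k^2-2l_k\sum_{j<k}l_j$, and these add up to
$-(\sum_{k<N}l_k)^2$. So the sum of squares is nonincreasing, and at $t=0$ it equals $N$. -/
lemma sum_sq_lagFun_le (N : ℕ) {t : ℝ} (ht : 0 ≤ t) :
    ∑ k ∈ Finset.range N, lagFun k 0 t ^ 2 ≤ N := by
  have hd : ∀ s, HasDerivAt (fun s => ∑ k ∈ Finset.range N, lagFun k 0 s ^ 2)
      (-(∑ k ∈ Finset.range N, lagFun k 0 s) ^ 2) s := by
    intro s
    have h1 : HasDerivAt (fun s => ∑ k ∈ Finset.range N, lagFun k 0 s ^ 2)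
        (∑ k ∈ Finset.range N, 2 * lagFun k 0 s * lagFun k 1 s) s := by
      refine HasDerivAt.fun_sum fun k _ => ?_
      have h := (hasDerivAt_lagFun k 0 s).mul (hasDerivAt_lagFun k 0 s)
      simp only [pow_two]
      exact h.congr_deriv (by ring)
    refine h1.congr_deriv ?_
    clear h1
    induction N with
    | zero => simp
    | succ N ih =>
      rw [Finset.sum_range_succ, Finset.sum_range_succ, ih, lagFun_succ_eq_sum]
      ring
  have hanti : Antitone (fun s => ∑ k ∈ Finset.range N, lagFun k 0 s ^ 2) :=
    antitone_of_hasDerivAt_nonpos hd fun s => by simpa using sq_nonneg _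
  simpa [lagFun_apply_zero] using hanti ht

lemma abs_lagFun_le (k : ℕ) {t : ℝ} (ht : 0 ≤ t) : |lagFun k 0 t| ≤ k + 1 := by
  have h1 := sum_sq_lagFun_le (k + 1) ht
  have h2 : lagFun k 0 t ^ 2 ≤ k + 1 := by
    refine le_trans ?_ (by exact_mod_cast h1)
    exact Finset.single_le_sum (f := fun k => lagFun k 0 t ^ 2) (fun _ _ => sq_nonneg _)
      (Finset.self_mem_range_succ k)
  have : (0 : ℝ) ≤ k := by positivity
  refine abs_le_of_sq_le_sq ?_ (by positivity)
  nlinarith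

/-- All derivatives of Laguerre functions decay rapidly on the half line, with bounds that grow
polynomially in the degree. -/
lemma exists_lagFun_bound (i β : ℕ) : ∃ C : ℝ, ∃ M : ℕ, 0 ≤ C ∧ ∀ (k : ℕ) (t : ℝ), 0 ≤ t →
    t ^ β * |lagFun k i t| ≤ C * (k + 1 : ℝ) ^ M := by
  induction i with
  | zero =>
    induction β with
    | zero => exact ⟨1, 1, zero_le_one, fun k t ht => by simpa using abs_lagFun_le k ht⟩
    | succ β ih =>
      obtain ⟨C, M, hC, h⟩ := ih
      -- Lets the three neighbouring indices share one bound: $k+1\le l+2\le2(l+1)$, whence the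
      -- factor $2^M$.
      have hmono : ∀ k l : ℕ, k ≤ l + 1 → ∀ t : ℝ, 0 ≤ t →
          t ^ β * |lagFun k 0 t| ≤ C * 2 ^ M * (l + 1 : ℝ) ^ M := by
        intro k l hkl t ht
        refine (h k t ht).trans ?_
        rw [mul_assoc, ← mul_pow]
        have : (k : ℝ) ≤ l + 1 := by exact_mod_cast hkl
        gcongr
        linarith
      -- At degree $k+1$ the recurrence coefficients sum to $(2k+3)+(k+2)+(k+1)\le4(k+2)$: one more
      -- power of the degree and a factor $4$.
      refine ⟨4 * (C * 2 ^ M), M + 1, by positivity, fun k t ht => ?_⟩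
      have hb : 0 ≤ t ^ β := pow_nonneg ht β
      cases k with
      | zero =>
        rw [pow_succ, mul_assoc, ← abs_of_nonneg ht, ← abs_mul, abs_of_nonneg ht, mul_lagFun_zero]
        have h1 := hmono 0 0 (by omega) t ht
        have h2 := hmono 1 0 (by omega) t ht
        have h3 := abs_sub (lagFun 0 0 t) (lagFun 1 0 t)
        have h4 := mul_le_mul_of_nonneg_left h3 hb
        have h5 : 0 ≤ C * 2 ^ M := by positivity
        simp only [Nat.cast_zero, zero_add, one_pow, mul_one] at h1 h2 ⊢
        linarith
      | succ k =>
        rw [pow_succ, mul_assoc, ← abs_of_nonneg ht, ← abs_mul, abs_of_nonneg ht, mul_lagFun_succ]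
        have h1 := hmono k (k + 1) (by omega) t ht
        have h2 := hmono (k + 1) (k + 1) (by omega) t ht
        have h3 := hmono (k + 2) (k + 1) (by omega) t ht
        have h4 : |(2 * k + 3) * lagFun (k + 1) 0 t - (k + 2) * lagFun (k + 2) 0 t
            - (k + 1) * lagFun k 0 t| ≤ (2 * k + 3) * |lagFun (k + 1) 0 t| +
              (k + 2) * |lagFun (k + 2) 0 t| + (k + 1) * |lagFun k 0 t| := by
          refine (abs_sub _ _).trans (add_le_add ((abs_sub _ _).trans (add_le_add ?_ ?_)) ?_) <;>
          rw [abs_mul, abs_of_nonneg (by positivity)]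
        set K := C * 2 ^ M * (((k + 1 : ℕ) : ℝ) + 1) ^ M with hK
        have hK0 : 0 ≤ K := by positivity
        calc _ ≤ t ^ β * ((2 * k + 3) * |lagFun (k + 1) 0 t| +
              (k + 2) * |lagFun (k + 2) 0 t| + (k + 1) * |lagFun k 0 t|) :=
              mul_le_mul_of_nonneg_left h4 hb
          _ = (2 * k + 3) * (t ^ β * |lagFun (k + 1) 0 t|) +
              (k + 2) * (t ^ β * |lagFun (k + 2) 0 t|) + (k + 1) * (t ^ β * |lagFun k 0 t|) := by
              ring
          _ ≤ (2 * k + 3) * K + (k + 2) * K + (k + 1) * K := by gcongr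
          _ ≤ 4 * (((k + 1 : ℕ) : ℝ) + 1) * K := by push_cast; nlinarith
          _ = _ := by rw [hK]; ring
  | succ i ih =>
    obtain ⟨C, M, hC, h⟩ := ih
    -- The derivative is dominated by $k+1$ functions of degree at most $k$, so the constant
    -- survives and the exponent rises by one.
    refine ⟨C, M + 1, hC, fun k t ht => ?_⟩
    have hb : 0 ≤ t ^ β := pow_nonneg ht β
    have hk := h k t ht
    calc t ^ β * |lagFun k (i + 1) t|
        ≤ t ^ β * (|lagFun k i t| + ∑ j ∈ Finset.range k, |lagFun j i t|) := by
          gcongr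
          rw [lagFun_succ_eq_sum]
          refine (abs_sub _ _).trans (add_le_add ?_ (Finset.abs_sum_le_sum_abs _ _))
          rw [abs_div, abs_neg, abs_two]
          linarith [abs_nonneg (lagFun k i t)]
      _ = t ^ β * |lagFun k i t| + ∑ j ∈ Finset.range k, t ^ β * |lagFun j i t| := by
          rw [mul_add, Finset.mul_sum]
      _ ≤ C * (k + 1 : ℝ) ^ M + ∑ j ∈ Finset.range k, C * (k + 1 : ℝ) ^ M := by
          refine add_le_add hk (Finset.sum_le_sum fun j hj => (h j t ht).trans ?_)
          have : (j : ℝ) ≤ k := by exact_mod_cast (Finset.mem_range.1 hj).le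
          gcongr
      _ = C * (k + 1 : ℝ) ^ (M + 1) := by
          rw [Finset.sum_const, Finset.card_range, nsmul_eq_mul]; ring

/-! ### Orthonormality -/

open MeasureTheory Filter Topology

lemma tendsto_lagFun_atTop (k i : ℕ) : Tendsto (lagFun k i) atTop (𝓝 0) := by
  obtain ⟨C, M, hC, h⟩ := exists_lagFun_bound i 1
  rw [tendsto_zero_iff_abs_tendsto_zero]
  refine squeeze_zero' (Eventually.of_forall fun t => abs_nonneg _)
    ?_ (tendsto_const_nhds.div_atTop tendsto_id : Tendsto (fun t : ℝ => C * (k + 1 : ℝ) ^ M / t)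
      atTop (𝓝 0))
  filter_upwards [eventually_gt_atTop 0] with t ht
  rw [Function.comp_apply, le_div_iff₀ ht, mul_comm]
  simpa using h k t ht.le

lemma integrableOn_lagFun (k i : ℕ) :
    IntegrableOn (fun t => lagFun k i t) (Set.Ioi 0) := by
  obtain ⟨C, M, hC, h⟩ := exists_lagFun_bound i 0
  obtain ⟨D, N, hD, h'⟩ := exists_lagFun_bound i 2
  have hint : Integrable (fun t : ℝ => (C * (k + 1 : ℝ) ^ M + D * (k + 1 : ℝ) ^ N) *
      (1 + t ^ 2)⁻¹) := integrable_inv_one_add_sq.const_mul _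
  refine Integrable.mono' hint.integrableOn
    (continuous_lagFun k i).aestronglyMeasurable ?_
  filter_upwards [ae_restrict_mem measurableSet_Ioi] with t ht
  rw [Real.norm_eq_abs, ← div_eq_mul_inv, le_div_iff₀ (by positivity)]
  have h1 := h k t (le_of_lt ht)
  have h2 := h' k t (le_of_lt ht)
  simp only [pow_zero, one_mul] at h1
  linarith

lemma integrableOn_lagFun_mul_lagFun (j k i i' : ℕ) :
    IntegrableOn (fun t => lagFun j i t * lagFun k i' t) (Set.Ioi 0) := by
  obtain ⟨C, M, hC, h⟩ := exists_lagFun_bound i 0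
  refine Integrable.bdd_mul (c := C * (j + 1 : ℝ) ^ M) (integrableOn_lagFun k i')
    (continuous_lagFun j i).aestronglyMeasurable ?_
  filter_upwards [ae_restrict_mem measurableSet_Ioi] with t ht
  simpa using h j t (le_of_lt ht)

/-- Integrate $(l_jl_k)'$ over the half line: the boundary terms give $-1$ since $l_j(0)=l_k(0)=1$.
The derivative formula expands the integrand, its two halves $-\frac12l_jl_k$ merging into the first
integral. -/
lemma integral_lagFun_relation (j k : ℕ) :
    (∫ t in Set.Ioi (0 : ℝ), lagFun j 0 t * lagFun k 0 t)
      + ∑ i ∈ Finset.range j, (∫ t in Set.Ioi (0 : ℝ), lagFun i 0 t * lagFun k 0 t)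
      + ∑ i ∈ Finset.range k, (∫ t in Set.Ioi (0 : ℝ), lagFun j 0 t * lagFun i 0 t) = 1 := by
  have h := integral_Ioi_of_hasDerivAt_of_tendsto' (a := (0 : ℝ))
    (f := fun t => lagFun j 0 t * lagFun k 0 t)
    (f' := fun t => lagFun j 1 t * lagFun k 0 t + lagFun j 0 t * lagFun k 1 t) (m := 0)
    (fun t _ => (hasDerivAt_lagFun j 0 t).mul (hasDerivAt_lagFun k 0 t))
    ((integrableOn_lagFun_mul_lagFun _ _ _ _).add (integrableOn_lagFun_mul_lagFun _ _ _ _))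
    (by simpa using (tendsto_lagFun_atTop j 0).mul (tendsto_lagFun_atTop k 0))
  have h2 : ∀ t, lagFun j 1 t * lagFun k 0 t + lagFun j 0 t * lagFun k 1 t =
      -(lagFun j 0 t * lagFun k 0 t + ∑ i ∈ Finset.range j, lagFun i 0 t * lagFun k 0 t
        + ∑ i ∈ Finset.range k, lagFun j 0 t * lagFun i 0 t) := by
    intro t
    rw [lagFun_succ_eq_sum, lagFun_succ_eq_sum, ← Finset.sum_mul, ← Finset.mul_sum]
    ring
  simp only [h2, lagFun_apply_zero] at h
  have hs1 : Integrable (fun t => ∑ i ∈ Finset.range j, lagFun i 0 t * lagFun k 0 t)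
      (volume.restrict (Set.Ioi 0)) :=
    integrable_finsetSum _ fun i _ => integrableOn_lagFun_mul_lagFun _ _ _ _
  have hs2 : Integrable (fun t => ∑ i ∈ Finset.range k, lagFun j 0 t * lagFun i 0 t)
      (volume.restrict (Set.Ioi 0)) :=
    integrable_finsetSum _ fun i _ => integrableOn_lagFun_mul_lagFun _ _ _ _
  have hs0 := integrableOn_lagFun_mul_lagFun j k 0 0
  have e1 := integral_add (hs0.add hs1) hs2
  simp only [Pi.add_apply] at e1
  rw [integral_neg, e1, integral_add hs0 hs1,
    integral_finsetSum _ fun i _ => integrableOn_lagFun_mul_lagFun _ _ _ _,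
    integral_finsetSum _ fun i _ => integrableOn_lagFun_mul_lagFun _ _ _ _] at h
  linarith

/-- The Laguerre functions are orthonormal on the half line. -/
lemma integral_lagFun_mul_lagFun (j k : ℕ) :
    ∫ t in Set.Ioi (0 : ℝ), lagFun j 0 t * lagFun k 0 t = if j = k then 1 else 0 := by
  -- In the relation every integral but the first has a smaller index sum. If $j\ne k$, exactly one
  -- of the two sums contains a diagonal term, which already accounts for the $1$; if $j=k$, neither
  -- does.
  induction hn : j + k using Nat.strong_induction_on generalizing j k with
  | _ n ih =>
    have h := integral_lagFun_relation j k
    rw [Finset.sum_congr rfl fun i hi => ih (i + k) (by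
        have := Finset.mem_range.1 hi; omega) i k rfl,
      Finset.sum_congr rfl fun i hi => ih (j + i) (by
        have := Finset.mem_range.1 hi; omega) j i rfl] at h
    simp only [Finset.sum_ite_eq', Finset.sum_ite_eq, Finset.mem_range] at h
    rcases lt_trichotomy j k with hjk | hjk | hjk
    · simp only [hjk, hjk.not_gt, hjk.ne, if_true, if_false] at h ⊢
      linarith
    · simp only [hjk, lt_irrefl, if_true, if_false] at h ⊢
      linarith
    · simp only [hjk, hjk.not_gt, hjk.ne', if_true, if_false] at h ⊢
      linarith

/-! ### Growth of the multipliers -/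

lemma eventually_exp_le_norm_multiplier {z : ℂ} (hz : 0 < z.re) (c : ℂ) (r : ℝ) :
    ∀ᶠ k : ℕ in atTop, Real.exp (z.re / 2 * (k : ℝ) ^ r) ≤
      ‖Complex.exp (z * ((k : ℂ) + c) ^ (r : ℂ))‖ := by
  have h1 : Tendsto (fun k : ℕ => 1 + c / (k : ℂ)) atTop (𝓝 1) := by
    have h := (tendsto_inv_atTop_nhds_zero_nat (𝕜 := ℂ)).const_mul c
    simpa [div_eq_mul_inv] using h.const_add 1
  have h2 : Tendsto (fun k : ℕ => (z * (1 + c / (k : ℂ)) ^ (r : ℂ)).re) atTop (𝓝 z.re) := by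
    have hc : ContinuousAt (fun w : ℂ => w ^ (r : ℂ)) 1 :=
      continuousAt_cpow_const (by simp [Complex.slitPlane])
    have h := (hc.tendsto.comp h1).const_mul z
    simp only [Complex.one_cpow, mul_one] at h
    exact (Complex.continuous_re.tendsto z).comp h
  filter_upwards [h2.eventually_const_lt (half_lt_self hz), eventually_gt_atTop 0,
    h1.eventually_ne one_ne_zero] with k hk hk0 hne
  have hkpos : (0 : ℝ) < k := by exact_mod_cast hk0
  have hkne : (k : ℂ) ≠ 0 := by exact_mod_cast hk0.ne'
  -- Pulling out the positive real factor $k$ leaves the argument unchanged, so the principal power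
  -- splits.
  have h3 : ((k : ℂ) + c) ^ (r : ℂ) = ((k : ℝ) ^ r : ℝ) * (1 + c / (k : ℂ)) ^ (r : ℂ) := by
    have h4 : (k : ℂ) + c = ((k : ℝ) : ℂ) * (1 + c / (k : ℂ)) := by
      push_cast; field_simp
    have h5 : ((k : ℝ) : ℂ) ≠ 0 := by simpa using hkne
    rw [h4, Complex.cpow_def_of_ne_zero (mul_ne_zero h5 hne), Complex.log_ofReal_mul hkpos hne,
      add_mul, Complex.exp_add, Complex.cpow_def_of_ne_zero hne,
      Real.rpow_def_of_pos hkpos]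
    push_cast
    rfl
  rw [Complex.norm_exp, h3, Real.exp_le_exp]
  have h6 : (z * (((k : ℝ) ^ r : ℝ) * (1 + c / (k : ℂ)) ^ (r : ℂ))).re =
      (k : ℝ) ^ r * (z * (1 + c / (k : ℂ)) ^ (r : ℂ)).re := by
    rw [← Complex.re_ofReal_mul]; ring_nf
  rw [h6, mul_comm]
  exact mul_le_mul_of_nonneg_left hk.le (by positivity)

lemma tendsto_natCast_rpow_atTop {r : ℝ} (hr : 0 < r) :
    Tendsto (fun k : ℕ => (k : ℝ) ^ r) atTop atTop :=
  (tendsto_rpow_atTop hr).comp tendsto_natCast_atTop_atTop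

lemma tendsto_rpow_sub_rpow_atTop {A r s : ℝ} (hA : 0 < A) (B : ℝ) (hr : 0 < r) (hs : s < r) :
    Tendsto (fun k : ℕ => A * (k : ℝ) ^ r - B * (k : ℝ) ^ s) atTop atTop := by
  have h1 : Tendsto (fun k : ℕ => A - B * (k : ℝ) ^ (-(r - s))) atTop (𝓝 A) := by
    have h := ((tendsto_rpow_neg_atTop (sub_pos.2 hs)).comp
      tendsto_natCast_atTop_atTop).const_mul B
    simpa using h.const_sub A
  refine ((tendsto_natCast_rpow_atTop hr).atTop_mul_pos hA h1).congr' ?_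
  filter_upwards [eventually_gt_atTop 0] with k hk
  have hkpos : (0 : ℝ) < k := by exact_mod_cast hk
  have h2 : (k : ℝ) ^ s = (k : ℝ) ^ r * (k : ℝ) ^ (-(r - s)) := by
    rw [← Real.rpow_add hkpos]; ring_nf
  rw [h2]; ring

/-- Equal exponents are allowed, at the price of $B<A$; this is what admits the endpoint
$\alpha_2=1/r$. -/
lemma tendsto_rpow_sub_rpow_atTop_of_lt {A B r s : ℝ} (hB : 0 ≤ B) (hBA : B < A) (hr : 0 < r)
    (hs : s ≤ r) :
    Tendsto (fun k : ℕ => A * (k : ℝ) ^ r - B * (k : ℝ) ^ s) atTop atTop := by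
  refine tendsto_atTop_mono' atTop ?_
    ((tendsto_natCast_rpow_atTop hr).const_mul_atTop (sub_pos.2 hBA))
  filter_upwards [eventually_ge_atTop 1] with k hk
  have hk1 : (1 : ℝ) ≤ k := by exact_mod_cast hk
  have := mul_le_mul_of_nonneg_left (Real.rpow_le_rpow_of_exponent_le hk1 hs) hB
  linarith

lemma tendsto_norm_multiplier_mul_exp {z : ℂ} (hz : 0 < z.re) (c : ℂ) {r : ℝ}
    {u : ℕ → ℝ} (hu : Tendsto (fun k : ℕ => z.re / 2 * (k : ℝ) ^ r - u k) atTop atTop) :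
    Tendsto (fun k : ℕ => ‖Complex.exp (z * ((k : ℂ) + c) ^ (r : ℂ))‖ * Real.exp (-u k))
      atTop atTop := by
  refine tendsto_atTop_mono' atTop ?_ (Real.tendsto_exp_atTop.comp hu)
  filter_upwards [eventually_exp_le_norm_multiplier hz c r] with k hk
  rw [Function.comp_apply, sub_eq_add_neg, Real.exp_add]
  gcongr

/-! ### Formal series with one term -/

lemma len_single {d : ℕ} (i : Fin d) (k : ℕ) : len (Pi.single i k) = k := by
  simp [len]

/-- The formal series `a l_n` with only one term. -/
def singleSeries {d : ℕ} (n : Fin d → ℕ) (a : ℂ) : FormalSeries d :=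
  fun m => if m = n then a else 0

lemma propagator_singleSeries {d : ℕ} (z c : ℂ) (r : ℝ) (n : Fin d → ℕ) (a : ℂ) :
    propagator z c r (singleSeries n a) =
      singleSeries n (Complex.exp (z * ((len n : ℂ) + c) ^ (r : ℂ)) * a) := by
  funext m
  by_cases h : m = n <;> simp [propagator, singleSeries, h]

lemma propagator_zero {d : ℕ} (z c : ℂ) (r : ℝ) :
    propagator z c r (0 : FormalSeries d) = 0 := by
  funext m
  exact mul_zero _

lemma singleSeries_term_le {d : ℕ} (α h : ℝ) (n : Fin d → ℕ) (a : ℂ) (m : Fin d → ℕ) :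
    ‖singleSeries n a m‖ * Real.exp (h * (len m : ℝ) ^ (1 / α)) ≤
      ‖a‖ * Real.exp (h * (len n : ℝ) ^ (1 / α)) := by
  by_cases hm : m = n
  · simp [singleSeries, hm]
  · simp only [singleSeries, hm, if_false, norm_zero, zero_mul]
    positivity

lemma singleSeries_mem_step {d : ℕ} (α h : ℝ) (n : Fin d → ℕ) (a : ℂ) :
    singleSeries n a ∈ step d α h := by
  refine ⟨‖a‖ * Real.exp (h * (len n : ℝ) ^ (1 / α)), ?_⟩
  rintro _ ⟨m, rfl⟩
  exact singleSeries_term_le α h n a m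

lemma stepNorm_singleSeries {d : ℕ} (α h : ℝ) (n : Fin d → ℕ) (a : ℂ) :
    stepNorm α h (singleSeries n a) = ‖a‖ * Real.exp (h * (len n : ℝ) ^ (1 / α)) := by
  refine le_antisymm (ciSup_le fun m => singleSeries_term_le α h n a m) ?_
  refine le_trans (le_of_eq ?_) (le_ciSup (singleSeries_mem_step α h n a) n)
  simp [singleSeries]

/-- The formal series with coefficients `e^{-ε |n|^{1/α}}`. -/
def expSeries (d : ℕ) (α ε : ℝ) : FormalSeries d :=
  fun n => (Real.exp (-ε * (len n : ℝ) ^ (1 / α)) : ℂ)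

lemma expSeries_mem_step {d : ℕ} {α ε β h : ℝ}
    (hbdd : BddAbove (Set.range fun k : ℕ => h * (k : ℝ) ^ (1 / β) - ε * (k : ℝ) ^ (1 / α))) :
    expSeries d α ε ∈ step d β h := by
  obtain ⟨C, hC⟩ := hbdd
  refine ⟨Real.exp C, ?_⟩
  rintro _ ⟨n, rfl⟩
  have h1 : _ ≤ C := hC ⟨len n, rfl⟩
  simp only [expSeries, Complex.norm_real, Real.norm_eq_abs, Real.abs_exp]
  rw [← Real.exp_add, Real.exp_le_exp]
  linarith

/-! ### A criterion for discontinuity -/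

/-- Sequential criterion. The hypothesis `hnot` ranges over all possible images because a
realisation of the operator is prescribed only through `ιB`. -/
lemma discontinuous_of_tendsto {d : ℕ} {A B : Type} [TopologicalSpace A] [TopologicalSpace B]
    {T : FormalSeries d → FormalSeries d} {ιA : A → FormalSeries d} {ιB : B → FormalSeries d}
    {x : ℕ → A} {x₀ : A} (hx : ∀ k, x k ∈ maxDomain T ιA ιB) (hx₀ : x₀ ∈ maxDomain T ιA ιB)
    (hlim : Tendsto x atTop (𝓝 x₀))
    (hnot : ∀ (y : ℕ → B) (y₀ : B), (∀ k, ιB (y k) = T (ιA (x k))) → ιB y₀ = T (ιA x₀) →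
      ¬ Tendsto y atTop (𝓝 y₀)) :
    Discontinuous T ιA ιB := by
  intro Φ hΦ hcont
  have h1 : Tendsto (fun k => (⟨x k, hx k⟩ : maxDomain T ιA ιB)) atTop (𝓝 ⟨x₀, hx₀⟩) :=
    tendsto_subtype_rng.2 hlim
  exact hnot _ _ (fun k => hΦ ⟨x k, hx k⟩) (hΦ ⟨x₀, hx₀⟩) ((hcont.tendsto _).comp h1)

/-- The common core of (ii) and (iii), with weight $w_k=e^{-\varepsilon k^{1/\alpha}}$ as
coefficient and as the weight of a norm on $W$. The parameter $\alpha$ need not be the one that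
defines $V$ and $W$. -/
lemma discontinuous_and_not_wellDefined_of_step {d : ℕ} (hd : 0 < d) {z : ℂ} (hz : 0 < z.re)
    (c : ℂ) {r α ε : ℝ}
    (htend : Tendsto (fun k : ℕ => z.re / 2 * (k : ℝ) ^ r - 2 * ε * (k : ℝ) ^ (1 / α)) atTop atTop)
    (V W : Submodule ℂ (FormalSeries d)) [TopologicalSpace V] [TopologicalSpace W]
    (hexp : expSeries d α ε ∈ V) (hV : ∀ n a, singleSeries n a ∈ V)
    (hW : ∀ n a, singleSeries n a ∈ W) (hWstep : W ≤ step d α (-ε))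
    (hcont : Continuous (stepSeminorm W α (-ε) hWstep))
    (hlim : ∀ i : Fin d, Tendsto (fun k : ℕ => (⟨singleSeries (Pi.single i k)
      (Real.exp (-ε * (k : ℝ) ^ (1 / α)) : ℂ), hV _ _⟩ : V)) atTop (𝓝 0)) :
    Discontinuous (propagator z c r) (Subtype.val : V → FormalSeries d)
        (Subtype.val : W → FormalSeries d) ∧
      ¬ WellDefined (propagator z c r) (Subtype.val : V → FormalSeries d)
        (Subtype.val : W → FormalSeries d) := by
  have hmult := tendsto_norm_multiplier_mul_exp hz c htend
  have hsplit : ∀ k : ℕ, Real.exp (-(2 * ε * (k : ℝ) ^ (1 / α))) =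
      Real.exp (-ε * (k : ℝ) ^ (1 / α)) * Real.exp (-ε * (k : ℝ) ^ (1 / α)) := by
    intro k
    rw [← Real.exp_add]; ring_nf
  let i : Fin d := ⟨0, hd⟩
  refine ⟨discontinuous_of_tendsto (fun k => ⟨⟨_, hW _ _⟩, (propagator_singleSeries ..).symm⟩)
    ⟨0, (propagator_zero z c r).symm⟩ (hlim i) fun y y₀ hy hy₀ h => ?_, fun hwd => ?_⟩
  -- A limit would force the step norms of the images to converge, but these norms are $|m_k|w_k^2$.
  · refine not_tendsto_atTop_of_tendsto_nhds ((hcont.tendsto y₀).comp h) (hmult.congr fun k => ?_)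
    have h1 : (stepSeminorm W α (-ε) hWstep) (y k) = stepNorm α (-ε) (y k).1 := rfl
    rw [Function.comp_apply, h1, hy, propagator_singleSeries, stepNorm_singleSeries, len_single,
      norm_mul, Complex.norm_real, Real.norm_eq_abs, Real.abs_exp, hsplit]
    ring
  · obtain ⟨g, hg⟩ := hwd ⟨_, hexp⟩
    obtain ⟨C, hC⟩ := hWstep g.2
    refine not_bddAbove_of_tendsto_atTop hmult ⟨C, ?_⟩
    rintro _ ⟨k, rfl⟩
    refine le_trans (le_of_eq ?_) (hC ⟨Pi.single i k, rfl⟩)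
    simp only [hg, propagator, expSeries, len_single, norm_mul, Complex.norm_real,
      Real.norm_eq_abs, Real.abs_exp, hsplit]
    ring

/-! ### The spaces `𝒢_{0,α}` and `𝒢_α` -/

/-- Comparing weights gives a continuous inclusion of one step in another, even across different
values of $\alpha$. -/
lemma norm_mul_exp_le_stepNorm {d : ℕ} {α β h h' : ℝ} {C : ℝ}
    (hC : ∀ k : ℕ, h' * (k : ℝ) ^ (1 / β) - h * (k : ℝ) ^ (1 / α) ≤ C)
    {a : FormalSeries d} (ha : a ∈ step d α h) (n : Fin d → ℕ) :
    ‖a n‖ * Real.exp (h' * (len n : ℝ) ^ (1 / β)) ≤ Real.exp C * stepNorm α h a := by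
  have h1 : ‖a n‖ * Real.exp (h * (len n : ℝ) ^ (1 / α)) ≤ stepNorm α h a := le_ciSup ha n
  have h2 : Real.exp (h' * (len n : ℝ) ^ (1 / β)) ≤
      Real.exp C * Real.exp (h * (len n : ℝ) ^ (1 / α)) := by
    rw [← Real.exp_add, Real.exp_le_exp]
    linarith [hC (len n)]
  calc _ ≤ ‖a n‖ * (Real.exp C * Real.exp (h * (len n : ℝ) ^ (1 / α))) := by gcongr
    _ = Real.exp C * (‖a n‖ * Real.exp (h * (len n : ℝ) ^ (1 / α))) := by ring
    _ ≤ _ := by gcongr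

lemma exists_rpow_sub_rpow_le {s t : ℝ} (ht : 0 < t) (hst : s < t) (h : ℝ) :
    ∃ C : ℝ, ∀ k : ℕ, h * (k : ℝ) ^ s - 1 * (k : ℝ) ^ t ≤ C := by
  obtain ⟨m, hm⟩ := bddBelow_range_of_tendsto_atTop_atTop
    (tendsto_rpow_sub_rpow_atTop one_pos h ht hst)
  exact ⟨-m, fun k => by have : m ≤ _ := hm ⟨k, rfl⟩; linarith⟩

theorem gZeroSpace_discontinuous {d : ℕ} (hd : 0 < d) {z : ℂ} (hz : 0 < z.re) (c : ℂ) {r α : ℝ}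
    (hr : 0 < r) (hα : 1 / r < α) :
    Discontinuous (propagator z c r) (Subtype.val : GZeroSpace d α → FormalSeries d)
        (Subtype.val : GZeroDual d α → FormalSeries d) ∧
      ¬ WellDefined (propagator z c r) (Subtype.val : GZeroSpace d α → FormalSeries d)
        (Subtype.val : GZeroDual d α → FormalSeries d) := by
  have hα0 : 0 < α := (one_div_pos.2 hr).trans hα
  -- The weight $e^{-k^s}$ beats every $e^{hk^{1/\alpha}}$ yet loses to the multiplier. It is the
  -- step weight with $1/s$ in place of $\alpha$.
  obtain ⟨s, hs1, hs2⟩ := exists_between ((one_div_lt hr hα0).1 hα)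
  have hs0 : 0 < s := (one_div_pos.2 hα0).trans hs1
  have hss : 1 / (1 / s) = s := one_div_one_div s
  have hle : ∀ h : ℝ, ∃ C : ℝ, ∀ k : ℕ,
      h * (k : ℝ) ^ (1 / α) - 1 * (k : ℝ) ^ (1 / (1 / s)) ≤ C := by
    rw [hss]; exact exists_rpow_sub_rpow_le hs0 hs1
  have hle' : ∀ h : ℝ, ∃ C : ℝ, ∀ k : ℕ,
      -1 * (k : ℝ) ^ (1 / (1 / s)) - h * (k : ℝ) ^ (1 / α) ≤ C := by
    intro h
    obtain ⟨C, hC⟩ := hle (-h)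
    exact ⟨C, fun k => by linarith [hC k]⟩
  have hWstep : GZeroDual d α ≤ step d (1 / s) (-1) := by
    rintro a ⟨h, hh, ha⟩
    obtain ⟨C, hC⟩ := hle' (-h)
    refine ⟨Real.exp C * stepNorm α (-h) a, ?_⟩
    rintro _ ⟨n, rfl⟩
    exact norm_mul_exp_le_stepNorm hC ha n
  have hWS : WithSeminorms (fun p : {p : Seminorm ℂ (GZeroDual d α) // ∀ h ∈ {h : ℝ | h < 0},
      ∃ C : ℝ, ∀ a : GZeroDual d α, a.1 ∈ step d α h → p a ≤ C * stepNorm α h a.1} => p.1) :=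
    ⟨rfl⟩
  have hVS : WithSeminorms (fun h : {h : ℝ // 0 < h} =>
      stepSeminorm (GZeroSpace d α) α h.1 (fun _ ha => ha h.1 h.2)) := ⟨rfl⟩
  refine discontinuous_and_not_wellDefined_of_step hd hz c (α := 1 / s) (ε := 1) ?_ _ _ ?_
    (fun n a h _ => singleSeries_mem_step α h n a)
    (fun n a => ⟨1, one_pos, singleSeries_mem_step α (-1) n a⟩) hWstep ?_ ?_
  · rw [hss]
    exact tendsto_rpow_sub_rpow_atTop (half_pos hz) _ hr hs2
  · intro h _
    obtain ⟨C, hC⟩ := hle h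
    exact expSeries_mem_step ⟨C, by rintro _ ⟨k, rfl⟩; exact hC k⟩
  -- On each step of the inductive limit this seminorm is bounded by a multiple of the step norm, so
  -- it belongs to the family defining the topology.
  · refine hWS.continuous_seminorm ⟨stepSeminorm (GZeroDual d α) (1 / s) (-1) hWstep, ?_⟩
    intro h _
    obtain ⟨C, hC⟩ := hle' h
    exact ⟨Real.exp C, fun a ha => ciSup_le fun n => norm_mul_exp_le_stepNorm hC ha n⟩
  · intro i
    refine (hVS.tendsto_nhds _ _).2 fun h ε hε => ?_
    have h1 : Tendsto (fun k : ℕ => Real.exp (-(1 * (k : ℝ) ^ s - h.1 * (k : ℝ) ^ (1 / α))))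
        atTop (𝓝 0) := Real.tendsto_exp_neg_atTop_nhds_zero.comp
      (tendsto_rpow_sub_rpow_atTop one_pos h.1 hs0 hs1)
    filter_upwards [h1.eventually_lt_const hε] with k hk
    rw [sub_zero]
    refine lt_of_eq_of_lt ?_ hk
    refine (stepNorm_singleSeries ..).trans ?_
    rw [Complex.norm_real, Real.norm_eq_abs, Real.abs_exp, ← Real.exp_add, len_single, hss]
    ring_nf

theorem gSpace_discontinuous {d : ℕ} (hd : 0 < d) {z : ℂ} (hz : 0 < z.re) (c : ℂ) {r α : ℝ}
    (hr : 0 < r) (hα : 1 / r ≤ α) :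
    Discontinuous (propagator z c r) (Subtype.val : GSpace d α → FormalSeries d)
        (Subtype.val : GDual d α → FormalSeries d) ∧
      ¬ WellDefined (propagator z c r) (Subtype.val : GSpace d α → FormalSeries d)
        (Subtype.val : GDual d α → FormalSeries d) := by
  have hα0 : 0 < α := (one_div_pos.2 hr).trans_le hα
  have hαr : 1 / α ≤ r := (one_div_le hr hα0).1 hα
  -- With equal exponents the growth condition reads $2\varepsilon<\operatorname{Re}z/2$.
  set ε : ℝ := z.re / 8 with hε
  have hε0 : 0 < ε := by positivity
  have hVS : WithSeminorms (fun p : {p : Seminorm ℂ (GSpace d α) // ∀ h ∈ {h : ℝ | 0 < h},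
      ∃ C : ℝ, ∀ a : GSpace d α, a.1 ∈ step d α h → p a ≤ C * stepNorm α h a.1} => p.1) :=
    ⟨rfl⟩
  have hWS : WithSeminorms (fun h : {h : ℝ // 0 < h} =>
      stepSeminorm (GDual d α) α (-h.1) (fun _ ha => ha h.1 h.2)) := ⟨rfl⟩
  refine discontinuous_and_not_wellDefined_of_step hd hz c (α := α) (ε := ε) ?_ _ _ ?_
    (fun n a => ⟨1, one_pos, singleSeries_mem_step α 1 n a⟩)
    (fun n a h _ => singleSeries_mem_step α (-h) n a)
    (fun _ ha => ha ε hε0) (hWS.continuous_seminorm ⟨ε, hε0⟩) ?_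
  · exact tendsto_rpow_sub_rpow_atTop_of_lt (by positivity) (by linarith) hr hαr
  · refine ⟨ε, hε0, expSeries_mem_step ⟨0, ?_⟩⟩
    rintro _ ⟨k, rfl⟩
    simp
  · intro i
    refine (hVS.tendsto_nhds _ _).2 fun p δ hδ => ?_
    -- In the step $\varepsilon$ itself the vectors have norm $1$; in the larger step
    -- $\varepsilon/2$ they tend to $0$.
    obtain ⟨C, hC⟩ := p.2 (ε / 2) (by simpa using hε0)
    have h1 : Tendsto (fun k : ℕ => C * Real.exp (-(ε / 2 * (k : ℝ) ^ (1 / α))))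
        atTop (𝓝 0) := by
      simpa using (Real.tendsto_exp_neg_atTop_nhds_zero.comp
        ((tendsto_natCast_rpow_atTop (one_div_pos.2 hα0)).const_mul_atTop
          (half_pos hε0))).const_mul C
    filter_upwards [h1.eventually_lt_const hδ] with k hk
    rw [sub_zero]
    refine lt_of_le_of_lt (hC _ (singleSeries_mem_step ..)) (lt_of_eq_of_lt ?_ hk)
    rw [stepNorm_singleSeries, Complex.norm_real, Real.norm_eq_abs, Real.abs_exp, ← Real.exp_add,
      len_single]
    ring_nf

/-! ### Rapidly convergent Laguerre series in one variable -/

/-- Rapidly decreasing real sequences. -/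
def RapidDecay (b : ℕ → ℝ) : Prop := ∀ M : ℕ, Summable fun k => |b k| * (k + 1 : ℝ) ^ M

lemma rapidDecay_single (k : ℕ) (a : ℝ) : RapidDecay (Pi.single k a) := by
  intro M
  refine summable_of_ne_finset_zero (s := {k}) fun m hm => ?_
  have hm' : m ≠ k := by simpa using hm
  simp [hm']

lemma tsum_single_weight (k M : ℕ) (a : ℝ) :
    ∑' m, |(Pi.single k a : ℕ → ℝ) m| * (m + 1 : ℝ) ^ M = |a| * (k + 1 : ℝ) ^ M := by
  rw [tsum_eq_single k fun m hm => by simp [hm]]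
  simp

/-- The `i`-th derivative of the series `∑ b_k L_k(t) e^{-t/2}`. -/
def lagSeries (b : ℕ → ℝ) (i : ℕ) (t : ℝ) : ℝ := ∑' k, b k * lagFun k i t

lemma lagSeries_single (k : ℕ) (a : ℝ) (i : ℕ) (t : ℝ) :
    lagSeries (Pi.single k a) i t = a * lagFun k i t := by
  rw [lagSeries, tsum_eq_single k fun m hm => by simp [hm]]
  simp

/-- The constants do not depend on $b$, so one estimate serves both for the infinite series and for
single Laguerre functions. -/
lemma exists_lagSeries_bound (i β : ℕ) : ∃ C : ℝ, ∃ M : ℕ, 0 ≤ C ∧ ∀ b, RapidDecay b →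
    ∀ t : ℝ, 0 ≤ t → t ^ β * |lagSeries b i t| ≤ C * ∑' k, |b k| * (k + 1 : ℝ) ^ M := by
  obtain ⟨C, M, hC, h⟩ := exists_lagFun_bound i β
  refine ⟨C, M, hC, fun b hb t ht => ?_⟩
  have h1 := tsum_of_norm_bounded (f := fun k => t ^ β * (b k * lagFun k i t))
    ((hb M).mul_left C).hasSum fun k => ?_
  · rw [tsum_mul_left, tsum_mul_left, norm_mul, Real.norm_eq_abs, Real.norm_eq_abs,
      abs_of_nonneg (pow_nonneg ht β)] at h1
    exact h1
  · rw [Real.norm_eq_abs, abs_mul, abs_mul, abs_of_nonneg (pow_nonneg ht β)]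
    calc t ^ β * (|b k| * |lagFun k i t|) = |b k| * (t ^ β * |lagFun k i t|) := by ring
      _ ≤ |b k| * (C * (k + 1 : ℝ) ^ M) := mul_le_mul_of_nonneg_left (h k t ht) (abs_nonneg _)
      _ = _ := by ring

lemma exists_summable_bound {b : ℕ → ℝ} (hb : RapidDecay b) (i : ℕ) :
    ∃ u : ℕ → ℝ, Summable u ∧ ∀ k t, 0 ≤ t → ‖b k * lagFun k i t‖ ≤ u k := by
  obtain ⟨C, M, hC, h⟩ := exists_lagFun_bound i 0
  refine ⟨_, (hb M).mul_left C, fun k t ht => ?_⟩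
  have := h k t ht
  rw [pow_zero, one_mul] at this
  rw [Real.norm_eq_abs, abs_mul]
  calc |b k| * |lagFun k i t| ≤ |b k| * (C * (k + 1 : ℝ) ^ M) := by gcongr
    _ = _ := by ring

lemma continuousOn_lagSeries {b : ℕ → ℝ} (hb : RapidDecay b) (i : ℕ) :
    ContinuousOn (lagSeries b i) (Set.Ici 0) := by
  obtain ⟨u, hu, h⟩ := exists_summable_bound hb i
  exact continuousOn_tsum
    (fun k => (continuous_const.mul (continuous_lagFun k i)).continuousOn) hu h

lemma hasDerivAt_lagSeries {b : ℕ → ℝ} (hb : RapidDecay b) (i : ℕ) {t : ℝ} (ht : 0 < t) :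
    HasDerivAt (lagSeries b i) (lagSeries b (i + 1) t) t := by
  obtain ⟨u, hu, h⟩ := exists_summable_bound hb i
  obtain ⟨v, hv, h'⟩ := exists_summable_bound hb (i + 1)
  exact hasDerivAt_tsum_of_isPreconnected hv isOpen_Ioi isPreconnected_Ioi
    (fun k s _ => (hasDerivAt_lagFun k i s).const_mul (b k))
    (fun k s hs => h' k s (le_of_lt hs)) ht (.of_norm_bounded hu fun k => h k t ht.le) ht

lemma contDiffOn_lagSeries {b : ℕ → ℝ} (hb : RapidDecay b) (i : ℕ) :
    ContDiffOn ℝ ∞ (lagSeries b i) (Set.Ioi 0) := by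
  rw [contDiffOn_infty]
  intro n
  induction n generalizing i with
  | zero =>
    exact contDiffOn_zero.2 ((continuousOn_lagSeries hb i).mono Set.Ioi_subset_Ici_self)
  | succ n ih =>
    push_cast
    rw [contDiffOn_succ_iff_deriv_of_isOpen isOpen_Ioi]
    refine ⟨fun t ht => (hasDerivAt_lagSeries hb i ht).differentiableAt.differentiableWithinAt,
      by simp, (ih (i + 1)).congr fun t ht => (hasDerivAt_lagSeries hb i ht).deriv⟩

/-! ### Laguerre series along one coordinate axis -/

/-- The function `u(x_ι) ∏_{j ≠ ι} e^{-x_j/2}`, where `u` is the `i`-th derivative of the series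
`∑ b_k L_k(t) e^{-t/2}`. -/
def axisSeries {d : ℕ} (ι : Fin d) (b : ℕ → ℝ) (i : ℕ) (x : Fin d → ℝ) : ℂ :=
  ((lagSeries b i (x ι) * Real.exp (-(∑ j ∈ Finset.univ.erase ι, x j) / 2) : ℝ) : ℂ)

lemma continuousOn_axisSeries {d : ℕ} (ι : Fin d) {b : ℕ → ℝ} (hb : RapidDecay b) (i : ℕ) :
    ContinuousOn (axisSeries ι b i) (closedOrthant d) := by
  refine Complex.continuous_ofReal.comp_continuousOn (ContinuousOn.mul
    ((continuousOn_lagSeries hb i).comp (continuous_apply ι).continuousOn fun x hx => hx ι) ?_)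
  exact Continuous.continuousOn (by fun_prop)

lemma contDiffOn_axisSeries {d : ℕ} (ι : Fin d) {b : ℕ → ℝ} (hb : RapidDecay b) (i : ℕ) :
    ContDiffOn ℝ ∞ (axisSeries ι b i) (orthant d) := by
  refine Complex.ofRealCLM.contDiff.comp_contDiffOn (ContDiffOn.mul
    ((contDiffOn_lagSeries hb i).comp (contDiff_apply ℝ ℝ ι).contDiffOn fun x hx => hx ι)
    (ContDiff.contDiffOn ?_))
  exact Real.contDiff_exp.comp
    ((ContDiff.sum fun j _ => contDiff_apply ℝ ℝ j).neg.div_const 2)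

lemma partialDeriv_axisSeries {d : ℕ} (ι : Fin d) {b : ℕ → ℝ} (hb : RapidDecay b) (i : ℕ)
    (j : Fin d) {x : Fin d → ℝ} (hx : x ∈ orthant d) :
    partialDeriv j (axisSeries ι b i) x =
      if j = ι then axisSeries ι b (i + 1) x else (-(1 / 2) : ℂ) * axisSeries ι b i x := by
  have hs : HasFDerivAt (fun y : Fin d → ℝ => -(∑ j ∈ Finset.univ.erase ι, y j) / 2)
      (-(2⁻¹ : ℝ) • ∑ j ∈ Finset.univ.erase ι,
        (ContinuousLinearMap.proj j : (Fin d → ℝ) →L[ℝ] ℝ)) x := by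
    have h0 : HasFDerivAt (fun y : Fin d → ℝ => ∑ j ∈ Finset.univ.erase ι, y j)
        (∑ j ∈ Finset.univ.erase ι, (ContinuousLinearMap.proj j : (Fin d → ℝ) →L[ℝ] ℝ)) x :=
      HasFDerivAt.fun_sum fun j _ => hasFDerivAt_apply j x
    have h1 := h0.const_mul (-(2⁻¹ : ℝ))
    have h2 : (fun y : Fin d → ℝ => -(∑ j ∈ Finset.univ.erase ι, y j) / 2) =
        fun y => -(2⁻¹ : ℝ) * ∑ j ∈ Finset.univ.erase ι, y j := by
      ext y; ring
    rw [h2]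
    exact h1
  have hu : HasFDerivAt (fun y : Fin d → ℝ => lagSeries b i (y ι))
      (lagSeries b (i + 1) (x ι) • (ContinuousLinearMap.proj ι : (Fin d → ℝ) →L[ℝ] ℝ)) x :=
    HasDerivAt.comp_hasFDerivAt (f := fun y : Fin d → ℝ => y ι) x
      (hasDerivAt_lagSeries hb i (hx ι)) (hasFDerivAt_apply ι x)
  have h := Complex.ofRealCLM.hasFDerivAt.comp x (hu.mul hs.exp)
  have h' : fderiv ℝ (axisSeries ι b i) x = _ := h.fderiv
  rw [partialDeriv, h']
  by_cases hj : j = ι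
  · subst hj
    simp [axisSeries, Pi.single_apply, mul_comm]
  · simp [axisSeries, Pi.single_apply, hj, Ne.symm hj]
    ring

/-- Up to a constant, partial derivatives of `axisSeries` only differentiate the series. -/
lemma exists_multiDeriv_axisSeries {d : ℕ} (ι : Fin d) (α : Fin d → ℕ) :
    ∃ (i : ℕ) (a : ℂ), ∀ b, RapidDecay b →
      Set.EqOn (multiDeriv α (axisSeries ι b 0)) (a • axisSeries ι b i) (orthant d) := by
  -- Stated for families indexed by $b$ so that the order and the constant are chosen before $b$.
  have hstep : ∀ (j : Fin d) (G : (ℕ → ℝ) → (Fin d → ℝ) → ℂ),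
      (∃ (i : ℕ) (a : ℂ), ∀ b, RapidDecay b → Set.EqOn (G b) (a • axisSeries ι b i) (orthant d)) →
      ∃ (i : ℕ) (a : ℂ), ∀ b, RapidDecay b →
        Set.EqOn (partialDeriv j (G b)) (a • axisSeries ι b i) (orthant d) := by
    rintro j G ⟨i, a, h⟩
    by_cases hj : j = ι
    · refine ⟨i + 1, a, fun b hb x hx => ?_⟩
      rw [partialDeriv_congr (h b hb) j hx,
        partialDeriv_smul (contDiffOn_axisSeries ι hb i) a j hx, Pi.smul_apply, Pi.smul_apply,
        partialDeriv_axisSeries ι hb i j hx, if_pos hj]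
    · refine ⟨i, a * -(1 / 2), fun b hb x hx => ?_⟩
      rw [partialDeriv_congr (h b hb) j hx,
        partialDeriv_smul (contDiffOn_axisSeries ι hb i) a j hx, Pi.smul_apply, Pi.smul_apply,
        partialDeriv_axisSeries ι hb i j hx, if_neg hj, smul_eq_mul, smul_eq_mul, mul_assoc]
  unfold multiDeriv
  induction List.finRange d with
  | nil => exact ⟨0, 1, fun b _ x _ => by simp⟩
  | cons j L ih =>
    simp only [List.foldr_cons]
    generalize α j = m
    induction m with
    | zero => exact ih
    | succ m ihm =>
      simp only [Function.iterate_succ_apply']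
      exact hstep j _ ihm

lemma pow_mul_exp_neg_half_le (n : ℕ) {t : ℝ} (ht : 0 ≤ t) :
    t ^ n * Real.exp (-t / 2) ≤ n.factorial * 2 ^ n := by
  have h2 := Real.pow_div_factorial_le_exp (t / 2) (by positivity) n
  rw [div_pow, div_div, div_le_iff₀ (by positivity)] at h2
  rw [neg_div, Real.exp_neg, ← div_eq_mul_inv, div_le_iff₀ (Real.exp_pos _)]
  linarith

/-- The Schwartz seminorms of `axisSeries` are controlled by weighted `ℓ¹` norms. -/
lemma exists_multiDeriv_axisSeries_bound {d : ℕ} (ι : Fin d) (α β : Fin d → ℕ) :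
    ∃ C : ℝ, ∃ M : ℕ, ∀ b, RapidDecay b → ∀ x ∈ orthant d,
      monom β x * ‖multiDeriv α (axisSeries ι b 0) x‖ ≤
        C * ∑' k, |b k| * (k + 1 : ℝ) ^ M := by
  obtain ⟨i, a, h⟩ := exists_multiDeriv_axisSeries ι α
  obtain ⟨C, M, hC, h'⟩ := exists_lagSeries_bound i (β ι)
  refine ⟨‖a‖ * (C * ∏ j ∈ Finset.univ.erase ι, ((β j).factorial * 2 ^ β j : ℝ)), M,
    fun b hb x hx => ?_⟩
  -- The weighted function factors over the coordinates; outside $\iota$ each factor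
  -- $x_j^{\beta_j}e^{-x_j/2}$ is bounded by a constant.
  have h1 : monom β x * |lagSeries b i (x ι) *
      Real.exp (-(∑ j ∈ Finset.univ.erase ι, x j) / 2)| = (x ι ^ β ι * |lagSeries b i (x ι)|) *
      ∏ j ∈ Finset.univ.erase ι, (x j ^ β j * Real.exp (-x j / 2)) := by
    rw [monom, ← Finset.mul_prod_erase Finset.univ _ (Finset.mem_univ ι), abs_mul, Real.abs_exp,
      Finset.prod_mul_distrib, ← Real.exp_sum, ← Finset.sum_div, Finset.sum_neg_distrib]
    ring
  rw [h b hb hx, Pi.smul_apply, norm_smul, axisSeries, Complex.norm_real, Real.norm_eq_abs,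
    mul_left_comm, h1]
  calc _ ≤ ‖a‖ * ((C * ∑' k, |b k| * (k + 1 : ℝ) ^ M) *
        ∏ j ∈ Finset.univ.erase ι, ((β j).factorial * 2 ^ β j : ℝ)) := by
        refine mul_le_mul_of_nonneg_left (mul_le_mul (h' b hb _ (hx ι).le) ?_ ?_ ?_)
          (norm_nonneg a)
        · exact Finset.prod_le_prod
            (fun j _ => mul_nonneg (pow_nonneg (hx j).le _) (Real.exp_pos _).le)
            fun j _ => pow_mul_exp_neg_half_le _ (hx j).le
        · exact Finset.prod_nonneg
            fun j _ => mul_nonneg (pow_nonneg (hx j).le _) (Real.exp_pos _).le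
        · exact mul_nonneg hC (tsum_nonneg fun k => by positivity)
    _ = _ := by ring

lemma isSchwartz_axisSeries {d : ℕ} (ι : Fin d) {b : ℕ → ℝ} (hb : RapidDecay b) :
    IsSchwartz ((orthant d).indicator (axisSeries ι b 0)) := by
  have he : Set.EqOn ((orthant d).indicator (axisSeries ι b 0)) (axisSeries ι b 0) (orthant d) :=
    fun x hx => Set.indicator_of_mem hx _
  refine ⟨fun x hx => Set.indicator_of_notMem hx _,
    (contDiffOn_axisSeries ι hb 0).congr he, fun α => ?_, fun α β => ?_⟩
  · obtain ⟨i, a, h⟩ := exists_multiDeriv_axisSeries ι α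
    refine ⟨a • axisSeries ι b i, (continuousOn_axisSeries ι hb i).const_smul a, fun x hx => ?_⟩
    rw [multiDeriv_congr he α hx, h b hb hx]
  · obtain ⟨C, M, h⟩ := exists_multiDeriv_axisSeries_bound ι α β
    refine ⟨C * ∑' k, |b k| * (k + 1 : ℝ) ^ M, ?_⟩
    rintro _ ⟨x, rfl⟩
    simpa only [multiDeriv_congr he α x.2] using h b hb x.1 x.2

/-- The sum of `∑ b_k l_{k e_ι}` as an element of `𝒮(ℝ^d_+)`. -/
def axisSchwartz {d : ℕ} (ι : Fin d) {b : ℕ → ℝ} (hb : RapidDecay b) : SchwartzOrthant d :=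
  ⟨_, isSchwartz_axisSeries ι hb⟩

lemma lagFun_zero_zero (t : ℝ) : lagFun 0 0 t = Real.exp (-t / 2) := by
  simp [lagFun, lagDerivPoly, lagPoly]

lemma laguerreFun_eq_prod {d : ℕ} (n : Fin d → ℕ) (x : Fin d → ℝ) :
    laguerreFun n x = ∏ j, lagFun (n j) 0 (x j) :=
  Finset.prod_congr rfl fun _ _ => laguerrePoly_mul_exp _ _

lemma laguerreFun_single {d : ℕ} (ι : Fin d) (k : ℕ) (x : Fin d → ℝ) :
    laguerreFun (Pi.single ι k) x =
      lagFun k 0 (x ι) * Real.exp (-(∑ j ∈ Finset.univ.erase ι, x j) / 2) := by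
  rw [laguerreFun_eq_prod, ← Finset.mul_prod_erase Finset.univ _ (Finset.mem_univ ι),
    Pi.single_eq_same, ← Finset.sum_neg_distrib, Finset.sum_div, Real.exp_sum]
  congr 1
  refine Finset.prod_congr rfl fun j hj => ?_
  rw [Pi.single_eq_of_ne (Finset.ne_of_mem_erase hj), lagFun_zero_zero]

lemma axisSeries_single {d : ℕ} (ι : Fin d) (k : ℕ) (x : Fin d → ℝ) :
    axisSeries ι (Pi.single k 1) 0 x = (laguerreFun (Pi.single ι k) x : ℂ) := by
  rw [axisSeries, lagSeries_single, one_mul, laguerreFun_single]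

lemma axisSeries_eq_tsum {d : ℕ} (ι : Fin d) (b : ℕ → ℝ) (x : Fin d → ℝ) :
    axisSeries ι b 0 x = ∑' k, (b k : ℂ) * (laguerreFun (Pi.single ι k) x : ℂ) := by
  rw [axisSeries, lagSeries, ← tsum_mul_right, Complex.ofReal_tsum]
  refine tsum_congr fun k => ?_
  rw [laguerreFun_single]
  push_cast
  ring

/-! ### Orthonormality in several variables -/

lemma volume_restrict_orthant (d : ℕ) : (volume : Measure (Fin d → ℝ)).restrict (orthant d) =
    Measure.pi fun _ => (volume : Measure ℝ).restrict (Set.Ioi 0) := by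
  have : orthant d = Set.univ.pi fun _ => Set.Ioi 0 := by ext; simp [orthant]
  rw [this, volume_pi, Measure.restrict_pi_pi]

lemma integrableOn_laguerreFun {d : ℕ} (n : Fin d → ℕ) :
    IntegrableOn (laguerreFun n) (orthant d) := by
  rw [IntegrableOn, volume_restrict_orthant, funext (laguerreFun_eq_prod n)]
  exact Integrable.fintype_prod fun j => integrableOn_lagFun (n j) 0

lemma integral_laguerreFun_mul_laguerreFun {d : ℕ} (m n : Fin d → ℕ) :
    ∫ x in orthant d, laguerreFun m x * laguerreFun n x = if m = n then 1 else 0 := by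
  simp only [laguerreFun_eq_prod, ← Finset.prod_mul_distrib]
  rw [volume_restrict_orthant, integral_fintype_prod_eq_prod
    (f := fun j (t : ℝ) => lagFun (m j) 0 t * lagFun (n j) 0 t)]
  simp only [integral_lagFun_mul_lagFun, Finset.prod_ite_zero, Finset.prod_const_one]
  simp [funext_iff]

lemma integral_ofReal_laguerreFun {d : ℕ} (m n : Fin d → ℕ) :
    ∫ x in orthant d, (laguerreFun m x : ℂ) * (laguerreFun n x : ℂ) =
      if m = n then 1 else 0 := by
  have h : ∀ x, (laguerreFun m x : ℂ) * (laguerreFun n x : ℂ) =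
      ((laguerreFun m x * laguerreFun n x : ℝ) : ℂ) := fun x => by push_cast; rfl
  simp only [h]
  rw [integral_complex_ofReal, integral_laguerreFun_mul_laguerreFun]
  split_ifs <;> simp

lemma measurableSet_orthant (d : ℕ) : MeasurableSet (orthant d) :=
  (isOpen_orthant d).measurableSet

lemma schwartzCoeff_laguerreSchwartz {d : ℕ} (m n : Fin d → ℕ) :
    schwartzCoeff (laguerreSchwartz m) n = if m = n then 1 else 0 := by
  rw [← integral_ofReal_laguerreFun]
  refine setIntegral_congr_fun (measurableSet_orthant d) fun x hx => ?_
  exact congrArg (· * (laguerreFun n x : ℂ))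
    (Set.indicator_of_mem hx fun y => (laguerreFun m y : ℂ))

lemma abs_laguerreFun_single_le {d : ℕ} (ι : Fin d) (k : ℕ) {x : Fin d → ℝ} (hx : x ∈ orthant d) :
    |laguerreFun (Pi.single ι k) x| ≤ (k : ℝ) + 1 := by
  rw [laguerreFun_single, abs_mul, Real.abs_exp]
  refine (mul_le_of_le_one_right (abs_nonneg _) (Real.exp_le_one_iff.2 ?_)).trans
    (abs_lagFun_le k (hx ι).le)
  have : 0 ≤ ∑ j ∈ Finset.univ.erase ι, x j := Finset.sum_nonneg fun j _ => (hx j).le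
  linarith

lemma continuous_laguerreFun {d : ℕ} (n : Fin d → ℕ) : Continuous (laguerreFun n) := by
  rw [funext (laguerreFun_eq_prod n)]
  exact continuous_finsetProd _ fun j _ => (continuous_lagFun _ 0).comp (continuous_apply j)

lemma schwartzCoeff_axisSchwartz {d : ℕ} (ι : Fin d) {b : ℕ → ℝ} (hb : RapidDecay b) (k : ℕ) :
    schwartzCoeff (axisSchwartz ι hb) (Pi.single ι k) = b k := by
  set n : Fin d → ℕ := Pi.single ι k with hn
  let F : ℕ → (Fin d → ℝ) → ℂ := fun m x =>
    (b m : ℂ) * ((laguerreFun (Pi.single ι m) x : ℂ) * (laguerreFun n x : ℂ))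
  have hint : ∀ m, Integrable (fun x => (laguerreFun (Pi.single ι m) x : ℂ) *
      (laguerreFun n x : ℂ)) (volume.restrict (orthant d)) := by
    intro m
    refine Integrable.bdd_mul (c := m + 1) (integrableOn_laguerreFun n).ofReal
      (Complex.continuous_ofReal.comp (continuous_laguerreFun _)).aestronglyMeasurable ?_
    filter_upwards [ae_restrict_mem (measurableSet_orthant d)] with x hx
    simpa using abs_laguerreFun_single_le ι m hx
  -- Since $|l_{me_\iota}|\le m+1$, one power of rapid decay justifies exchanging sum and integral;
  -- orthonormality then leaves a single term.
  have hsum : Summable fun m => ∫ x in orthant d, ‖F m x‖ := by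
    refine Summable.of_nonneg_of_le (fun m => integral_nonneg fun x => norm_nonneg _)
      (fun m => ?_) ((hb 1).mul_right (∫ x in orthant d, ‖laguerreFun n x‖))
    rw [← integral_const_mul]
    refine setIntegral_mono_on ((hint m).const_mul _).norm
      ((integrableOn_laguerreFun n).norm.const_mul _) (measurableSet_orthant d) fun x hx => ?_
    simp only [F, norm_mul, Complex.norm_real, Real.norm_eq_abs, pow_one]
    rw [mul_assoc]
    gcongr
    exact abs_laguerreFun_single_le ι m hx
  have h := hasSum_integral_of_summable_integral_norm (fun m => (hint m).const_mul _) hsum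
  have h1 : ∀ m, ∫ x in orthant d, F m x = if m = k then (b k : ℂ) else 0 := by
    intro m
    simp only [F]
    rw [integral_const_mul, integral_ofReal_laguerreFun]
    have : (Pi.single ι m : Fin d → ℕ) = n ↔ m = k := by
      rw [hn]; exact (Pi.single_injective ι).eq_iff
    simp only [this]
    by_cases hm : m = k <;> simp [hm]
  have h2 : HasSum (fun m => ∫ x in orthant d, F m x) (b k : ℂ) := by
    simp only [h1]
    exact hasSum_ite_eq k _
  refine Eq.trans ?_ (h.unique h2)
  refine setIntegral_congr_fun (measurableSet_orthant d) fun x hx => ?_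
  change (orthant d).indicator (axisSeries ι b 0) x * _ = ∑' m, F m x
  rw [Set.indicator_of_mem hx, axisSeries_eq_tsum, ← tsum_mul_right]
  exact tsum_congr fun m => by simp only [F]; ring

/-! ### Laguerre coefficients as tempered functionals -/

lemma withSeminorms_schwartzSeminorm (d : ℕ) : WithSeminorms (schwartzSeminorm d) := ⟨rfl⟩

lemma multiDeriv_zero {d : ℕ} (f : (Fin d → ℝ) → ℂ) : multiDeriv 0 f = f := by
  unfold multiDeriv
  induction List.finRange d with
  | nil => rfl
  | cons i L ih => exact ih

lemma norm_toFun_le_schwartzSeminorm {d : ℕ} (f : SchwartzOrthant d) {x : Fin d → ℝ}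
    (hx : x ∈ orthant d) : ‖f.toFun x‖ ≤ schwartzSeminorm d (0, 0) f := by
  have h : monom 0 x * ‖multiDeriv 0 f.toFun x‖ ≤ schwartzSeminorm d (0, 0) f :=
    le_ciSup (f.2.decay 0 0) (⟨x, hx⟩ : orthant d)
  simpa [monom, multiDeriv_zero] using h

lemma integrable_toFun_mul_laguerreFun {d : ℕ} (f : SchwartzOrthant d) (n : Fin d → ℕ) :
    Integrable (fun x => f.toFun x * (laguerreFun n x : ℂ)) (volume.restrict (orthant d)) := by
  refine Integrable.bdd_mul (c := schwartzSeminorm d (0, 0) f) (integrableOn_laguerreFun n).ofReal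
    (f.2.smooth.continuousOn.aestronglyMeasurable (measurableSet_orthant d)) ?_
  filter_upwards [ae_restrict_mem (measurableSet_orthant d)] with x hx
  exact norm_toFun_le_schwartzSeminorm f hx

/-- The linear functional `f ↦ ∫ f l_n` on `𝒮(ℝ^d_+)`. -/
def laguerreFunctional {d : ℕ} (n : Fin d → ℕ) : SchwartzOrthant d →ₗ[ℂ] ℂ where
  toFun f := schwartzCoeff f n
  map_add' f g := by
    rw [schwartzCoeff, schwartzCoeff, schwartzCoeff,
      ← integral_add (integrable_toFun_mul_laguerreFun f n) (integrable_toFun_mul_laguerreFun g n)]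
    exact integral_congr_ae (Eventually.of_forall fun x => add_mul _ _ _)
  map_smul' a f := by
    rw [schwartzCoeff, schwartzCoeff, RingHom.id_apply, smul_eq_mul, ← integral_const_mul]
    exact integral_congr_ae (Eventually.of_forall fun x => mul_assoc _ _ _)

/-- The functional `f ↦ ∫ f l_n` in `𝒮'(ℝ^d_+)`. -/
def laguerreTempered {d : ℕ} (n : Fin d → ℕ) : TemperedOrthant d where
  toLinearMap := laguerreFunctional n
  cont := by
    refine WithSeminorms.continuous_normedSpace_rng ℂ (withSeminorms_schwartzSeminorm d)
      (laguerreFunctional n) ⟨{(0, 0)}, ⟨∫ x in orthant d, ‖laguerreFun n x‖,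
        integral_nonneg fun x => norm_nonneg _⟩, fun f => ?_⟩
    rw [Finset.sup_singleton]
    change ‖∫ x in orthant d, f.toFun x * (laguerreFun n x : ℂ)‖ ≤
      (∫ x in orthant d, ‖laguerreFun n x‖) * schwartzSeminorm d (0, 0) f
    rw [mul_comm, ← integral_const_mul]
    refine norm_integral_le_of_norm_le ((integrableOn_laguerreFun n).norm.const_mul _) ?_
    filter_upwards [ae_restrict_mem (measurableSet_orthant d)] with x hx
    rw [norm_mul, Complex.norm_real]
    gcongr
    exact norm_toFun_le_schwartzSeminorm f hx

/-- By orthonormality every one-term series comes from $\mathcal S'$, which places the test vectors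
in the maximal domain. -/
lemma temperedCoeff_smul_laguerreTempered {d : ℕ} (a : ℂ) (n : Fin d → ℕ) :
    temperedCoeff (a • laguerreTempered n) = singleSeries n a := by
  funext m
  change a * schwartzCoeff (laguerreSchwartz m) n = if m = n then a else 0
  rw [schwartzCoeff_laguerreSchwartz]
  split_ifs <;> simp

lemma schwartzCoeff_smul_laguerreSchwartz {d : ℕ} (a : ℂ) (n : Fin d → ℕ) :
    schwartzCoeff (a • laguerreSchwartz n) = singleSeries n a := by
  funext m
  refine ((laguerreTempered m).map_smul a (laguerreSchwartz n)).trans ?_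
  change a * schwartzCoeff (laguerreSchwartz n) m = if m = n then a else 0
  rw [schwartzCoeff_laguerreSchwartz]
  simp only [eq_comm (a := n)]
  split_ifs <;> simp

/-! ### The spaces `𝒮` and `𝒮'` -/

/-- The Schwartz seminorms of the Laguerre functions grow polynomially. -/
lemma exists_schwartzSeminorm_laguerreSchwartz_le {d : ℕ} (ι : Fin d)
    (αβ : (Fin d → ℕ) × (Fin d → ℕ)) : ∃ C : ℝ, ∃ M : ℕ, ∀ k : ℕ,
      schwartzSeminorm d αβ (laguerreSchwartz (Pi.single ι k)) ≤ C * (k + 1 : ℝ) ^ M := by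
  obtain ⟨C, M, h⟩ := exists_multiDeriv_axisSeries_bound ι αβ.1 αβ.2
  have : Nonempty (orthant d) := ⟨⟨fun _ => 1, fun _ => one_pos⟩⟩
  refine ⟨C, M, fun k => ciSup_le fun x => ?_⟩
  -- The function $l_{ke_\iota}$ is the axis series of a unit vector, whose weighted $\ell^1$ norm
  -- is $(k+1)^M$.
  have h1 := h _ (rapidDecay_single k 1) x.1 x.2
  have he : Set.EqOn (laguerreSchwartz (Pi.single ι k)).toFun
      (axisSeries ι (Pi.single k 1) 0) (orthant d) := fun x hx => by
    rw [axisSeries_single]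
    exact Set.indicator_of_mem hx fun y => (laguerreFun (Pi.single ι k) y : ℂ)
  rw [tsum_single_weight, abs_one, one_mul] at h1
  rwa [multiDeriv_congr he αβ.1 x.2]

lemma tendsto_pow_mul_exp_neg_rpow {s : ℝ} (hs : 0 < s) (M : ℕ) :
    Tendsto (fun k : ℕ => (k + 1 : ℝ) ^ M * Real.exp (-(k : ℝ) ^ s)) atTop (𝓝 0) := by
  -- For $k\ge1$, $(k+1)^M\le2^Mk^M=2^M(k^s)^{M/s}$, which reduces to power against exponential in
  -- the variable $k^s$.
  have h1 : Tendsto (fun k : ℕ => 2 ^ M * (((k : ℝ) ^ s) ^ (M / s) *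
      Real.exp (-1 * (k : ℝ) ^ s))) atTop (𝓝 0) := by
    simpa using ((tendsto_rpow_mul_exp_neg_mul_atTop_nhds_zero (M / s) 1 one_pos).comp
      (tendsto_natCast_rpow_atTop hs)).const_mul (2 ^ M : ℝ)
  refine squeeze_zero' (Eventually.of_forall fun k => by positivity) ?_ h1
  filter_upwards [eventually_ge_atTop 1] with k hk
  have hk1 : (1 : ℝ) ≤ k := by exact_mod_cast hk
  rw [← Real.rpow_mul (by positivity), mul_div_cancel₀ _ hs.ne', Real.rpow_natCast, ← mul_assoc,
    ← mul_pow, neg_one_mul]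
  gcongr
  linarith

lemma rapidDecay_exp_neg_rpow {s : ℝ} (hs : 0 < s) :
    RapidDecay fun k => Real.exp (-(k : ℝ) ^ s) := by
  intro M
  -- The two extra powers leave a summable $(k+1)^{-2}$.
  obtain ⟨C, hC⟩ := (tendsto_pow_mul_exp_neg_rpow hs (M + 2)).bddAbove_range
  have h1 : Summable fun k : ℕ => C * (1 / ((k : ℝ) + 1) ^ 2) := by
    have h2 := (summable_nat_add_iff 1).2 (Real.summable_one_div_nat_pow.2 one_lt_two)
    push_cast at h2
    exact h2.mul_left C
  refine Summable.of_nonneg_of_le (fun k => by positivity) (fun k => ?_) h1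
  have h2 : _ ≤ C := hC ⟨k, rfl⟩
  rw [Real.abs_exp, mul_one_div, le_div_iff₀ (by positivity)]
  refine le_trans (le_of_eq ?_) h2
  ring

/-- The scaled Laguerre functions `e^{-k^s} l_{k e_ι}`. -/
def scaledLaguerre {d : ℕ} (ι : Fin d) (s : ℝ) (k : ℕ) : SchwartzOrthant d :=
  (Real.exp (-(k : ℝ) ^ s) : ℂ) • laguerreSchwartz (Pi.single ι k)

lemma tendsto_scaledLaguerre {d : ℕ} (ι : Fin d) {s : ℝ} (hs : 0 < s) :
    Tendsto (scaledLaguerre ι s) atTop (𝓝 0) := by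
  refine ((withSeminorms_schwartzSeminorm d).tendsto_nhds _ _).2 fun αβ ε hε => ?_
  obtain ⟨C, M, h⟩ := exists_schwartzSeminorm_laguerreSchwartz_le ι αβ
  have h1 := (tendsto_pow_mul_exp_neg_rpow hs M).const_mul C
  rw [mul_zero] at h1
  filter_upwards [h1.eventually_lt_const hε] with k hk
  rw [sub_zero, scaledLaguerre, map_smul_eq_mul, Complex.norm_real, Real.norm_eq_abs, Real.abs_exp]
  refine lt_of_le_of_lt (mul_le_mul_of_nonneg_left (h k) (Real.exp_pos _).le) (lt_of_eq_of_lt ?_ hk)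
  ring

theorem schwartz_discontinuous {d : ℕ} (hd : 0 < d) {z : ℂ} (hz : 0 < z.re) (c : ℂ) {r : ℝ}
    (hr : 0 < r) :
    Discontinuous (propagator z c r) (schwartzCoeff : SchwartzOrthant d → FormalSeries d)
        (temperedCoeff : TemperedOrthant d → FormalSeries d) ∧
      ¬ WellDefined (propagator z c r) (schwartzCoeff : SchwartzOrthant d → FormalSeries d)
        (temperedCoeff : TemperedOrthant d → FormalSeries d) := by
  let ι : Fin d := ⟨0, hd⟩
  let s := r / 2
  have hs : 0 < s := half_pos hr
  have hmult := tendsto_norm_multiplier_mul_exp hz c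
    (tendsto_rpow_sub_rpow_atTop (half_pos hz) 2 hr (half_lt_self hr))
  have hsplit : ∀ k : ℕ, Real.exp (-(2 * (k : ℝ) ^ s)) =
      Real.exp (-(k : ℝ) ^ s) * Real.exp (-(k : ℝ) ^ s) := by
    intro k
    rw [← Real.exp_add]; ring_nf
  have heval : ∀ (T : TemperedOrthant d) (k : ℕ), T (scaledLaguerre ι s k) =
      (Real.exp (-(k : ℝ) ^ s) : ℂ) * temperedCoeff T (Pi.single ι k) :=
    fun T k => T.map_smul _ _
  have hzero : schwartzCoeff (0 : SchwartzOrthant d) = 0 :=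
    funext fun n => (laguerreTempered n).map_zero
  have hcoeff : ∀ k, propagator z c r (schwartzCoeff (scaledLaguerre ι s k)) =
      singleSeries (Pi.single ι k) (Complex.exp (z * ((k : ℂ) + c) ^ (r : ℂ)) *
        (Real.exp (-(k : ℝ) ^ s) : ℂ)) := by
    intro k
    rw [scaledLaguerre, schwartzCoeff_smul_laguerreSchwartz, propagator_singleSeries, len_single]
  have : ContinuousSMul ℂ (SchwartzOrthant d) :=
    (withSeminorms_schwartzSeminorm d).continuousSMul
  have : IsTopologicalAddGroup (SchwartzOrthant d) :=
    (withSeminorms_schwartzSeminorm d).topologicalAddGroup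
  refine ⟨discontinuous_of_tendsto
    (fun k => ⟨_, (temperedCoeff_smul_laguerreTempered _ _).trans (hcoeff k).symm⟩)
    ⟨0, ?_⟩ (tendsto_scaledLaguerre ι hs) fun y y₀ hy hy₀ h => ?_, fun hwd => ?_⟩
  · rw [hzero, propagator_zero]; rfl
  -- A convergent sequence has bounded range, so strong convergence is uniform on it. At the $k$-th
  -- vector, however, the limit functional vanishes and the $k$-th image takes a value of modulus
  -- $|m_k|w_k^2$, eventually at least $1$.
  · have hB : Bornology.IsVonNBounded ℂ (Set.range (scaledLaguerre ι s)) :=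
      (tendsto_scaledLaguerre ι hs).isVonNBounded_range ℂ
    have hu := (UniformConvergenceCLM.tendsto_iff_tendstoUniformlyOn (RingHom.id ℂ) ℂ
      {S | Bornology.IsVonNBounded ℂ S}).1 h _ hB
    have h1 := Metric.tendstoUniformlyOn_iff.1 hu 1 one_pos
    obtain ⟨k, hk, hk'⟩ := (h1.and (hmult.eventually_ge_atTop 1)).exists
    have h2 := hk _ ⟨k, rfl⟩
    have e1 : y k (scaledLaguerre ι s k) = _ := heval (y k) k
    have e0 : y₀ (scaledLaguerre ι s k) = _ := heval y₀ k
    change dist (y₀ (scaledLaguerre ι s k)) (y k (scaledLaguerre ι s k)) < 1 at h2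
    rw [e1, e0, hy, hy₀, hzero, propagator_zero, hcoeff] at h2
    have e2 : (0 : FormalSeries d) (Pi.single ι k) = 0 := rfl
    rw [e2, mul_zero, dist_zero_left] at h2
    refine absurd hk' (not_le.2 (lt_of_eq_of_lt ?_ h2))
    simp only [singleSeries, if_true, norm_mul, Complex.norm_real, Real.norm_eq_abs, Real.abs_exp]
    rw [hsplit]
    ring
  · obtain ⟨T, hT⟩ := hwd (axisSchwartz ι (rapidDecay_exp_neg_rpow hs))
    -- Continuity of $T$ forces these values to $0$, whereas their moduli are $|m_k|w_k^2$.
    have h1 : Tendsto (fun k => ‖T (scaledLaguerre ι s k)‖) atTop (𝓝 0) := by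
      simpa using ((T.continuous.tendsto 0).comp (tendsto_scaledLaguerre ι hs)).norm
    refine not_tendsto_atTop_of_tendsto_nhds h1 (hmult.congr fun k => ?_)
    rw [heval, hT, propagator, schwartzCoeff_axisSchwartz, len_single]
    simp only [norm_mul, Complex.norm_real, Real.norm_eq_abs, Real.abs_exp]
    rw [hsplit]
    ring

end LaguerreOrthant

end

open LaguerreOrthant in
theorem theorem3p7 (d : ℕ) (hd : 0 < d) (z c : ℂ) (hz : 0 < z.re) (r α₁ α₂ : ℝ) (hr : 0 < r)
    (hα₁ : 1 / r < α₁) (hα₂ : 1 / r ≤ α₂) :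
    (Discontinuous (propagator z c r)
        (schwartzCoeff : SchwartzOrthant d → FormalSeries d)
        (temperedCoeff : TemperedOrthant d → FormalSeries d) ∧
      ¬ WellDefined (propagator z c r)
        (schwartzCoeff : SchwartzOrthant d → FormalSeries d)
        (temperedCoeff : TemperedOrthant d → FormalSeries d)) ∧
    (Discontinuous (propagator z c r)
        (Subtype.val : GZeroSpace d α₁ → FormalSeries d)
        (Subtype.val : GZeroDual d α₁ → FormalSeries d) ∧
      ¬ WellDefined (propagator z c r)
        (Subtype.val : GZeroSpace d α₁ → FormalSeries d)
        (Subtype.val : GZeroDual d α₁ → FormalSeries d)) ∧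
    (Discontinuous (propagator z c r)
        (Subtype.val : GSpace d α₂ → FormalSeries d)
        (Subtype.val : GDual d α₂ → FormalSeries d) ∧
      ¬ WellDefined (propagator z c r)
        (Subtype.val : GSpace d α₂ → FormalSeries d)
        (Subtype.val : GDual d α₂ → FormalSeries d)) := by
  exact ⟨schwartz_discontinuous hd hz c hr, gZeroSpace_discontinuous hd hz c hr hα₁,
    gSpace_discontinuous hd hz c hr hα₂⟩
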